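/- Let $\mathbb{F}=\mathbb{R}$ or $\mathbb{C}$. An $m\times n\times 2$ tensor $(A;B)$ over $\mathbb F$ is a pair of $m\times n$ matrices (its slices); its rank $\mathrm{rank}_{\mathbb F}(A;B)$ is the least number of tensors of the form $u\otimes v\otimes w$ ($u\in\mathbb F^m$, $v\in\mathbb F^n$, $w\in\mathbb F^2$) with sum $(A;B)$. The tensor is diagonalizable if there are nonsingular matrices $P\in\mathbb F^{m\times m}$, $Q\in\mathbb F^{n\times n}$ and diagonal matrices $D_A,D_B$ such that $PAQ=(D_A,O)$, $PBQ=(D_B,O)$ if $m\le n$, and $PAQ=(D_A,O)^T$, $PBQ=(D_B,O)^T$ if $m>n$. Let $E_k$ be the $k\times k$ identity matrix, $J_k$ the $k\times k$ nilpotent matrix with ones directly above the diagonal and zeros elsewhere, and $C_k(c,s)=E_k\otimes\begin{pmatrix}c&-s\\ s&c\end{pmatrix}$. Suppose that for some nonsingular $P,Q$ the tensor $(PAQ;PBQ)$ is a block diagonal sum (Kronecker canonical form) of blocks of the following types, where $k\ge 1$ in (B)-(F): - (A) zero blocks $(O;O)$ of size $k\times\ell\times2$, $k,\ell\ge0$;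 - (B) $(xE_k+J_k;E_k)$ with $x\in\mathbb F$; - (C) only if $\mathbb F=\mathbb R$: $(C_k(c,s)+J_k\otimes E_2;E_{2k})$ with $c,s\in\mathbb R$, $s\ne0$; - (D) $(E_k;J_k)$; - (E) $((\mathbf 0,E_k);(E_k,\mathbf 0))$, of size $k\times(k+1)\times2$; - (F) $\left(\begin{pmatrix}\mathbf 0^T\\E_k\end{pmatrix};\begin{pmatrix}E_k\\\mathbf 0^T\end{pmatrix}\right)$, of size $(k+1)\times k\times2$. Let $m_A$ and $n_A$ be the total numbers of rows and of columns of the blocks of type (A), and $\ell_E$, $\ell_F$ the numbers of blocks of type (E) and (F). Let $\alpha$ be the maximum (equal to $0$ if there are no such blocks) of the following numbers: for each $x\in\mathbb F$, the number of blocks of type (B) with parameter $x$ and $k\ge2$; the number of blocks of type (D) with $k\ge2$; and, if $\mathbb F=\mathbb R$, for each $(c,s)$ with $s\neq 0$, the number of blocks of type (C) (any $k\ge1$) with parameters $(c,s)$ or $(c,-s)$. Then $$m-m_A+\ell_E=n-n_A+\ell_F\qquad\text{and}\qquad \mathrm{rank}_{\mathbb F}(A;B)=\alpha+m-m_A+\ell_E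 .$$ Moreover, there is an $m\times n\times2$ tensor $T$ over $\mathbb F$ with $\mathrm{rank}_{\mathbb F}(T)=\alpha+\ell_E+\ell_F$ such that $(A;B)+T$ is diagonalizable. -/

import Mathlib

/-! An `m × n × l` tensor over `𝕜` is given by its `l` slices, `T : Fin l → Matrix (Fin m) (Fin n) 𝕜`.
In particular `(A;B)` is `![A, B]`. -/

/-- `T` is a sum of `r` simple tensors `u s ⊗ v s ⊗ w s`. -/
def IsSumOfSimple {𝕜 : Type*} [Field 𝕜] {m n l : ℕ} (T : Fin l → Matrix (Fin m) (Fin n) 𝕜)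
    (r : ℕ) : Prop :=
  ∃ (u : Fin r → Fin m → 𝕜) (v : Fin r → Fin n → 𝕜) (w : Fin r → Fin l → 𝕜),
    ∀ k i j, T k i j = ∑ s, u s i * v s j * w s k

/-- Every tensor is a finite sum of simple tensors, so the infimum below is a minimum. -/
theorem exists_isSumOfSimple {𝕜 : Type*} [Field 𝕜] {m n l : ℕ}
    (T : Fin l → Matrix (Fin m) (Fin n) 𝕜) : ∃ r, IsSumOfSimple T r := by
  classical
  let e := Fintype.equivFin (Fin m × Fin n × Fin l)
  refine ⟨_, fun s i => if (e.symm s).1 = i then T (e.symm s).2.2 i (e.symm s).2.1 else 0,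
    fun s j => if (e.symm s).2.1 = j then 1 else 0,
    fun s k => if (e.symm s).2.2 = k then 1 else 0, fun k i j => ?_⟩
  rw [e.symm.sum_comp (fun p : Fin m × Fin n × Fin l =>
    (if p.1 = i then T p.2.2 i p.2.1 else 0) * (if p.2.1 = j then 1 else 0) *
      (if p.2.2 = k then 1 else 0))]
  simp [Fintype.sum_prod_type]

/-- The rank of a tensor over `𝕜`: the least number of simple tensors with sum `T`. -/
noncomputable def tensorRank {𝕜 : Type*} [Field 𝕜] {m n l : ℕ}
    (T : Fin l → Matrix (Fin m) (Fin n) 𝕜) : ℕ :=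
  sInf {r | IsSumOfSimple T r}

/-- `T` is diagonalizable: there are nonsingular `P`, `Q` such that every slice of `P T Q` is a
rectangular diagonal matrix, i.e. `(D, O)` if `m ≤ n` and `(D, O)ᵀ` if `m > n`, `D` diagonal. -/
def IsDiagonalizableTensor {𝕜 : Type*} [Field 𝕜] {m n l : ℕ}
    (T : Fin l → Matrix (Fin m) (Fin n) 𝕜) : Prop :=
  ∃ (P : GL (Fin m) 𝕜) (Q : GL (Fin n) 𝕜), ∀ (k : Fin l) (i : Fin m) (j : Fin n),
    (i : ℕ) ≠ (j : ℕ) → ((P : Matrix (Fin m) (Fin m) 𝕜) * T k * (Q : Matrix (Fin n) (Fin n) 𝕜)) i j = 0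

/-- The nilpotent Jordan matrix `J_k`, with ones directly above the diagonal. -/
def nilJordan (𝕜 : Type*) [Field 𝕜] (k : ℕ) : Matrix (Fin k) (Fin k) 𝕜 :=
  Matrix.of fun i j => if (i : ℕ) + 1 = j then 1 else 0

/-- The `k × (k+1)` matrix `(0, E_k)`. -/
def zeroId (𝕜 : Type*) [Field 𝕜] (k : ℕ) : Matrix (Fin k) (Fin (k + 1)) 𝕜 :=
  Matrix.of fun i j => if (i : ℕ) + 1 = j then 1 else 0

/-- The `k × (k+1)` matrix `(E_k, 0)`. -/
def idZero (𝕜 : Type*) [Field 𝕜] (k : ℕ) : Matrix (Fin k) (Fin (k + 1)) 𝕜 :=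
  Matrix.of fun i j => if (i : ℕ) = j then 1 else 0

/-- Names of the blocks of a Kronecker canonical form; see `KroneckerBlock.tensor`. -/
inductive KroneckerBlock (𝕜 : Type*) where
  | typeA (k l : ℕ)
  | typeB (x : 𝕜) (k : ℕ)
  | typeC (c s : 𝕜) (k : ℕ)
  | typeD (k : ℕ)
  | typeE (k : ℕ)
  | typeF (k : ℕ)

namespace KroneckerBlock

/-- Number of rows. -/
def rows {𝕜 : Type*} : KroneckerBlock 𝕜 → ℕ
  | typeA k _ => k
  | typeB _ k => k
  | typeC _ _ k => k * 2
  | typeD k => k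
  | typeE k => k
  | typeF k => k + 1

/-- Number of columns. -/
def cols {𝕜 : Type*} : KroneckerBlock 𝕜 → ℕ
  | typeA _ l => l
  | typeB _ k => k
  | typeC _ _ k => k * 2
  | typeD k => k
  | typeE k => k + 1
  | typeF k => k

open scoped Kronecker in
/-- The two slices of a block. The equivalence `finProdFinEquiv` is `(a, b) ↦ 2 a + b`, the usual
ordering of a Kronecker product. -/
def tensor {𝕜 : Type*} [Field 𝕜] :
    (b : KroneckerBlock 𝕜) → Fin 2 → Matrix (Fin b.rows) (Fin b.cols) 𝕜
  | typeA k l => (![0, 0] : Fin 2 → Matrix (Fin k) (Fin l) 𝕜)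
  | typeB x k => (![x • 1 + nilJordan 𝕜 k, 1] : Fin 2 → Matrix (Fin k) (Fin k) 𝕜)
  | typeC c s k =>
      (![((1 : Matrix (Fin k) (Fin k) 𝕜) ⊗ₖ !![c, -s; s, c] +
          nilJordan 𝕜 k ⊗ₖ (1 : Matrix (Fin 2) (Fin 2) 𝕜)).submatrix
            finProdFinEquiv.symm finProdFinEquiv.symm, 1] :
        Fin 2 → Matrix (Fin (k * 2)) (Fin (k * 2)) 𝕜)
  | typeD k => (![1, nilJordan 𝕜 k] : Fin 2 → Matrix (Fin k) (Fin k) 𝕜)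
  | typeE k => (![zeroId 𝕜 k, idZero 𝕜 k] : Fin 2 → Matrix (Fin k) (Fin (k + 1)) 𝕜)
  | typeF k =>
      (![(zeroId 𝕜 k).transpose, (idZero 𝕜 k).transpose] :
        Fin 2 → Matrix (Fin (k + 1)) (Fin k) 𝕜)

/-- The restrictions on the parameters: blocks other than zero blocks have `k ≥ 1`, and blocks of
type C have `s ≠ 0` and occur only over the real field (expressed by `RCLike.I = 0`). -/
def Admissible {𝕜 : Type*} [RCLike 𝕜] : KroneckerBlock 𝕜 → Prop
  | typeA _ _ => True
  | typeB _ k => 1 ≤ k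
  | typeC _ s k => (RCLike.I : 𝕜) = 0 ∧ s ≠ 0 ∧ 1 ≤ k
  | typeD k => 1 ≤ k
  | typeE k => 1 ≤ k
  | typeF k => 1 ≤ k

/-- Number of rows contributed to the zero block. -/
def zeroRows {𝕜 : Type*} : KroneckerBlock 𝕜 → ℕ
  | typeA k _ => k
  | _ => 0

/-- Number of columns contributed to the zero block. -/
def zeroCols {𝕜 : Type*} : KroneckerBlock 𝕜 → ℕ
  | typeA _ l => l
  | _ => 0

end KroneckerBlock

/-- `b` lists the blocks of a Kronecker canonical form of `T`: for some nonsingular `P`, `Q`, the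
tensor `P T Q` is the block diagonal tensor with blocks `b 0, …, b (r-1)`. The bijections `e`, `f`
only name the rows and columns of the block diagonal tensor (any reordering is absorbed
in `P`, `Q`). -/
def IsKroneckerCanonicalForm {𝕜 : Type*} [RCLike 𝕜] {m n r : ℕ}
    (T : Fin 2 → Matrix (Fin m) (Fin n) 𝕜) (b : Fin r → KroneckerBlock 𝕜) : Prop :=
  (∀ i, (b i).Admissible) ∧
  ∃ (P : GL (Fin m) 𝕜) (Q : GL (Fin n) 𝕜)
    (e : Fin m ≃ (i : Fin r) × Fin (b i).rows) (f : Fin n ≃ (i : Fin r) × Fin (b i).cols),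
    ∀ k : Fin 2, (P : Matrix (Fin m) (Fin m) 𝕜) * T k * (Q : Matrix (Fin n) (Fin n) 𝕜) =
      (Matrix.blockDiagonal' fun i => (b i).tensor k).submatrix e f

/-- `m_A`. -/
def numZeroRows {𝕜 : Type*} {r : ℕ} (b : Fin r → KroneckerBlock 𝕜) : ℕ := ∑ i, (b i).zeroRows

/-- `n_A`. -/
def numZeroCols {𝕜 : Type*} {r : ℕ} (b : Fin r → KroneckerBlock 𝕜) : ℕ := ∑ i, (b i).zeroCols

/-- `ℓ_E`. -/
noncomputable def numTypeE {𝕜 : Type*} {r : ℕ} (b : Fin r → KroneckerBlock 𝕜) : ℕ :=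
  {i | ∃ k, b i = .typeE k}.ncard

/-- `ℓ_F`. -/
noncomputable def numTypeF {𝕜 : Type*} {r : ℕ} (b : Fin r → KroneckerBlock 𝕜) : ℕ :=
  {i | ∃ k, b i = .typeF k}.ncard

/-- The number of blocks `(x E_k + J_k; E_k)` with `k ≥ 2`. -/
noncomputable def countB {𝕜 : Type*} {r : ℕ} (b : Fin r → KroneckerBlock 𝕜) (x : 𝕜) : ℕ :=
  {i | ∃ k, 2 ≤ k ∧ b i = .typeB x k}.ncard

/-- The number of blocks `(E_k; J_k)` with `k ≥ 2`. -/
noncomputable def countD {𝕜 : Type*} {r : ℕ} (b : Fin r → KroneckerBlock 𝕜) : ℕ :=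
  {i | ∃ k, 2 ≤ k ∧ b i = .typeD k}.ncard

/-- The number of type C blocks with `k ≥ 1` and parameters `(c, s)` or `(c, -s)`; the blocks with
`(c, s)` and `(c, -s)` are equivalent. -/
noncomputable def countC {𝕜 : Type*} [Neg 𝕜] {r : ℕ} (b : Fin r → KroneckerBlock 𝕜)
    (c s : 𝕜) : ℕ :=
  {i | ∃ t k, (t = s ∨ t = -s) ∧ 1 ≤ k ∧ b i = .typeC c t k}.ncard

/-- `α`: the maximum of all the counts above (each count is at most `r`, so the suprema are
maxima). -/
noncomputable def kroneckerAlpha {𝕜 : Type*} [Neg 𝕜] {r : ℕ}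
    (b : Fin r → KroneckerBlock 𝕜) : ℕ :=
  max (⨆ x : 𝕜, countB b x) (max (countD b) (⨆ p : 𝕜 × 𝕜, countC b p.1 p.2))

/-!
The lower and the upper bound for the rank are proved for block diagonal tensors and carried over to
`(A; B)` by the nonsingular matrices of the canonical form.

**Lower bound.** If the columns of the blocks in a subfamily are linearly independent, the
substitution method (`IsSimpleSum.exists_of_independent_columns`) removes these blocks and, with
them, as many simple tensors as there are columns. Columns of blocks of type B to E and rows of
blocks of type F are independent, so one may pass to the blocks counted by one of the numbers that
make up `α` (`sum_baseRank_add_card_le`). A second application of the method, to all but the last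
two columns of each of these blocks, leaves a tensor `(x E + N; E)` of twice the size of their
number `q`, where `N ^ 2 = 0` and `N` has rank `q` for the types B and D, and `N ^ 2 = -s ^ 2` for
the type C. If `(M; E)` of size `n` is a sum of `r` simple tensors, the space is spanned by vectors
that are eigenvectors of `M` up to errors in a space of dimension at most `r - n`
(`IsSimpleSum.exists_approximate_eigenvectors`), and this gives `r ≥ 3 q` in both cases
(`IsSimpleSum.card_add_rank_le`, `IsSimpleSum.three_mul_card_le`).

**Upper bound.** Let `S = T 0 - t T 1` be invertible. If `N = S⁻¹ T 1` has a cyclic vector, then by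
pole placement (`IsCyclicVector.exists_diagonalization`) a perturbation of `N` of rank one is
diagonalizable, so `T` is diagonalizable up to one simple tensor (`IsCyclicPencil.isDiagonalUpTo`).
By the Chinese remainder theorem, a block diagonal sum of such tensors is of the same kind if the
polynomials annihilating the matrices `N` are coprime (`IsCyclicPencil.blockTensor`). The
nondiagonal blocks of type B, C, D can be distributed into `α` groups such that blocks in the same
group have different eigenvalues and hence coprime annihilators
(`KroneckerBlock.exists_coloring`), so one simple tensor per group suffices. Every block of type E
or F needs another one (`isDiagonalUpTo_typeE`).

The perturbation obtained in this way has rank at most `α + ℓ_E + ℓ_F`, and the diagonalizable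
tensor has rank at most the number of its diagonal entries. The sum of these two numbers is the
lower bound for the rank of `(A; B)`, so the perturbation has rank exactly `α + ℓ_E + ℓ_F`.
-/

open Matrix

/-! ### Sums of simple tensors -/

section SimpleSums

variable {𝕜 : Type*} [Field 𝕜] {ι κ ι' κ' : Type*}

/-- The tensor with slices `T 0`, `T 1`, rows indexed by `ι` and columns by `κ`, is a sum of `r`
simple tensors. The vectors of the simple tensors are the columns of `U`, the rows of `V` and the
pairs `(w 0 s, w 1 s)`. -/
def IsSimpleSum (T : Fin 2 → Matrix ι κ 𝕜) (r : ℕ) : Prop :=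
  ∃ (U : Matrix ι (Fin r) 𝕜) (w : Fin 2 → Fin r → 𝕜) (V : Matrix (Fin r) κ 𝕜),
    ∀ k, T k = U * diagonal (w k) * V

theorem isSimpleSum_iff_isSumOfSimple {m n r : ℕ} (T : Fin 2 → Matrix (Fin m) (Fin n) 𝕜) :
    IsSimpleSum T r ↔ IsSumOfSimple T r := by
  constructor
  · rintro ⟨U, w, V, h⟩
    refine ⟨fun s i => U i s, V, fun s k => w k s, fun k i j => ?_⟩
    rw [h, mul_apply]
    simp only [mul_diagonal]
    exact Finset.sum_congr rfl fun s _ => by ring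
  · rintro ⟨u, v, w, h⟩
    refine ⟨of fun i s => u s i, fun k s => w s k, of v, fun k => ?_⟩
    ext i j
    rw [h, mul_apply]
    simp only [mul_diagonal, of_apply]
    exact Finset.sum_congr rfl fun s _ => by ring

theorem IsSimpleSum.of_fintype {σ : Type*} [Fintype σ] [DecidableEq σ] {T : Fin 2 → Matrix ι κ 𝕜}
    (U : Matrix ι σ 𝕜) (w : Fin 2 → σ → 𝕜) (V : Matrix σ κ 𝕜)
    (h : ∀ k, T k = U * diagonal (w k) * V) {r : ℕ} (hr : Fintype.card σ = r) :
    IsSimpleSum T r := by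
  let e := Fintype.equivFinOfCardEq hr
  refine ⟨U.submatrix id e.symm, fun k => w k ∘ e.symm, V.submatrix e.symm id, fun k => ?_⟩
  rw [← submatrix_diagonal_equiv, submatrix_mul_equiv, submatrix_mul_equiv, h, submatrix_id_id]

theorem IsSimpleSum.mono {T : Fin 2 → Matrix ι κ 𝕜} {r s : ℕ} (h : IsSimpleSum T r)
    (hrs : r ≤ s) : IsSimpleSum T s := by
  obtain ⟨U, w, V, h⟩ := h
  refine .of_fintype (σ := Fin r ⊕ Fin (s - r)) (fromCols U 0) (fun k => Sum.elim (w k) 0)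
    (fromRows V 0) (fun k => ?_) (by simp; omega)
  rw [← fromBlocks_diagonal, h, fromCols_mul_fromBlocks, fromCols_mul_fromRows]
  simp

theorem IsSimpleSum.add {T T' : Fin 2 → Matrix ι κ 𝕜} {r s : ℕ} (h : IsSimpleSum T r)
    (h' : IsSimpleSum T' s) : IsSimpleSum (T + T') (r + s) := by
  obtain ⟨U, w, V, h⟩ := h
  obtain ⟨U', w', V', h'⟩ := h'
  refine .of_fintype (σ := Fin r ⊕ Fin s) (fromCols U U') (fun k => Sum.elim (w k) (w' k))
    (fromRows V V') (fun k => ?_) (by simp)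
  rw [← fromBlocks_diagonal, Pi.add_apply, h, h', fromCols_mul_fromBlocks, fromCols_mul_fromRows]
  simp

theorem IsSimpleSum.neg {T : Fin 2 → Matrix ι κ 𝕜} {r : ℕ} (h : IsSimpleSum T r) :
    IsSimpleSum (-T) r := by
  obtain ⟨U, w, V, h⟩ := h
  exact ⟨-U, w, V, fun k => by rw [Pi.neg_apply, h]; simp⟩

theorem IsSimpleSum.submatrix {T : Fin 2 → Matrix ι κ 𝕜} {r : ℕ} (h : IsSimpleSum T r)
    (f : ι' → ι) (g : κ' → κ) : IsSimpleSum (fun k => (T k).submatrix f g) r := by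
  obtain ⟨U, w, V, h⟩ := h
  refine ⟨U.submatrix f id, w, V.submatrix id g, fun k => ?_⟩
  simp only [h]
  rfl

theorem IsSimpleSum.mul [Fintype ι] [Fintype κ] {T : Fin 2 → Matrix ι κ 𝕜} {r : ℕ}
    (h : IsSimpleSum T r) (P : Matrix ι' ι 𝕜) (Q : Matrix κ κ' 𝕜) :
    IsSimpleSum (fun k => P * T k * Q) r := by
  obtain ⟨U, w, V, h⟩ := h
  exact ⟨P * U, w, V * Q, fun k => by simp only [h, Matrix.mul_assoc]⟩

theorem IsSimpleSum.transpose {T : Fin 2 → Matrix ι κ 𝕜} {r : ℕ} (h : IsSimpleSum T r) :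
    IsSimpleSum (fun k => (T k)ᵀ) r := by
  obtain ⟨U, w, V, h⟩ := h
  exact ⟨Vᵀ, w, Uᵀ, fun k => by simp [h, Matrix.mul_assoc]⟩

theorem IsSimpleSum.swap {A B : Matrix ι κ 𝕜} {r : ℕ} (h : IsSimpleSum ![A, B] r) :
    IsSimpleSum ![B, A] r := by
  obtain ⟨U, w, V, h⟩ := h
  refine ⟨U, ![w 1, w 0], V, fun k => ?_⟩
  fin_cases k
  · exact h 1
  · exact h 0

/-- The slices of the block diagonal sum of a family of tensors. -/
abbrev blockTensor {I : Type*} [DecidableEq I] {R C : I → Type*}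
    (T : ∀ i, Fin 2 → Matrix (R i) (C i) 𝕜) (k : Fin 2) :
    Matrix ((i : I) × R i) ((i : I) × C i) 𝕜 :=
  blockDiagonal' fun i => T i k

theorem IsSimpleSum.blockTensor {I : Type*} [Fintype I] [DecidableEq I] {R C : I → Type*}
    {T : ∀ i, Fin 2 → Matrix (R i) (C i) 𝕜} {r : I → ℕ} (h : ∀ i, IsSimpleSum (T i) (r i)) :
    IsSimpleSum (blockTensor T) (∑ i, r i) := by
  choose U w V h using h
  refine .of_fintype (σ := (i : I) × Fin (r i)) (blockDiagonal' U) (fun k x => w x.1 k x.2)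
    (blockDiagonal' V) (fun k => ?_) (by simp)
  rw [← blockDiagonal'_diagonal (fun i s => w i k s), ← blockDiagonal'_mul, ← blockDiagonal'_mul]
  simp only [_root_.blockTensor, h]

/-! ### The substitution method -/

/-- The substitution method: if the columns `j₁` of a sum of `r` simple tensors are linearly
independent (witnessed by `L`), the vectors of `card κ₁` of the simple tensors restrict to a basis
of the functionals on these columns. On the common kernel of these vectors, the coordinates `j₁` are
linear functions of the others, and `card κ₁` of the simple tensors vanish. Where the columns `j₁`
are zero, nothing else changes. -/
theorem IsSimpleSum.exists_of_independent_columns {κ₁ κ₂ ι₂ : Type*} [Fintype ι] [Fintype κ₁]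
    [DecidableEq κ₁] {T : Fin 2 → Matrix ι κ 𝕜} {r : ℕ} (h : IsSimpleSum T r)
    (j₁ : κ₁ → κ) (j₂ : κ₂ → κ) (ρ : ι₂ → ι) (hzero : ∀ k i c, T k (ρ i) (j₁ c) = 0)
    (L : Fin 2 → Matrix κ₁ ι 𝕜) (hL : ∑ k, L k * (T k).submatrix id j₁ = 1) :
    ∃ r', r = r' + Fintype.card κ₁ ∧ IsSimpleSum (fun k => (T k).submatrix ρ j₂) r' := by
  classical
  obtain ⟨U, w, V, h⟩ := h
  have hV : (∑ k, L k * (U * diagonal (w k))) * V.submatrix id j₁ = 1 := by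
    rw [← hL, Matrix.sum_mul]
    refine Finset.sum_congr rfl fun k _ => ?_
    rw [h, Matrix.mul_assoc]
    rfl
  set V₁ := V.submatrix id j₁
  set G := ∑ k, L k * (U * diagonal (w k))
  have hspan : Submodule.span 𝕜 (Set.range V₁) = ⊤ := by
    rw [eq_top_iff]
    rintro x -
    have : x = (x ᵥ* G) ᵥ* V₁ := by rw [vecMul_vecMul, hV, vecMul_one]
    rw [this, vecMul_eq_sum]
    exact Submodule.sum_mem _ fun s _ => Submodule.smul_mem _ _ (Submodule.subset_span ⟨s, rfl⟩)
  obtain ⟨τ, a, ha, hspan', hli⟩ := exists_linearIndependent' 𝕜 V₁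
  rw [hspan] at hspan'
  let bas : Module.Basis τ 𝕜 (κ₁ → 𝕜) := Module.Basis.mk hli hspan'.ge
  let _ : Fintype τ := Fintype.ofInjective a ha
  have hcard : Fintype.card τ = Fintype.card κ₁ := by
    rw [← Module.finrank_eq_card_basis bas, Module.finrank_fintype_fun_eq_card]
  let e : κ₁ ≃ τ := Fintype.equivOfCardEq hcard.symm
  let W : Matrix κ₁ κ₁ 𝕜 := V₁.submatrix (a ∘ e) id
  have hW : IsUnit W := by
    rw [← linearIndependent_rows_iff_isUnit]
    exact hli.comp e e.injective
  let X : Matrix κ₁ κ₂ 𝕜 := -(W⁻¹ * V.submatrix (a ∘ e) j₂)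
  let V' : Matrix (Fin r) κ₂ 𝕜 := V.submatrix id j₂ + V₁ * X
  have hV' : ∀ s ∈ Set.range a, ∀ j, V' s j = 0 := by
    rintro s ⟨t, rfl⟩ j
    obtain ⟨c, rfl⟩ := e.surjective t
    have : V'.submatrix (a ∘ e) id = 0 := by
      have h1 : V'.submatrix (a ∘ e) id = V.submatrix (a ∘ e) j₂ + W * X := rfl
      rw [h1, Matrix.mul_neg, Matrix.mul_nonsing_inv_cancel_left _ _
        ((isUnit_iff_isUnit_det _).1 hW), add_neg_cancel]
    exact congr_fun₂ this c j
  have hT : ∀ k, (T k).submatrix ρ j₂ = U.submatrix ρ id * diagonal (w k) * V' := by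
    intro k
    have h0 : (T k).submatrix ρ j₁ = 0 := by ext i c; exact hzero k i c
    have h1 : (T k).submatrix ρ j₁ = U.submatrix ρ id * diagonal (w k) * V₁ := by rw [h]; rfl
    rw [Matrix.mul_add, ← Matrix.mul_assoc _ V₁, ← h1, h0, Matrix.zero_mul, add_zero, h]
    rfl
  refine ⟨r - Fintype.card κ₁, ?_, ?_⟩
  · have := Fintype.card_le_of_injective a ha
    rw [hcard, Fintype.card_fin] at this
    omega
  · refine .of_fintype (σ := {s // s ∉ Set.range a}) (U.submatrix ρ Subtype.val)
      (fun k s => w k s) (V'.submatrix Subtype.val id) (fun k => ?_) ?_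
    · ext i j
      have hs : (T k).submatrix ρ j₂ i j = ∑ s, U (ρ i) s * w k s * V' s j := by
        rw [hT, mul_apply]
        simp only [mul_diagonal, submatrix_apply, id]
      rw [hs, mul_apply, ← Fintype.sum_subtype_add_sum_subtype (· ∈ Set.range a),
        Finset.sum_eq_zero, zero_add]
      · simp only [mul_diagonal, submatrix_apply, id]
      · rintro ⟨s, hs⟩ -
        rw [hV' s hs, mul_zero]
    · rw [Fintype.card_subtype_compl, Fintype.card_fin, ← hcard]
      congr 1
      exact Fintype.card_congr (Equiv.ofInjective a ha).symm

/-- The substitution method for block diagonal tensors: if the columns of the blocks selected by `p`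
are independent, the tensor formed by the other blocks selected by `q` needs fewer simple tensors,
and the difference is the number of these columns. -/
theorem IsSimpleSum.peel_columns {I : Type*} [Fintype I] [DecidableEq I] {R C : I → Type*}
    [∀ i, Fintype (R i)] [∀ i, Fintype (C i)] [∀ i, DecidableEq (C i)]
    {T : ∀ i, Fin 2 → Matrix (R i) (C i) 𝕜} {r : ℕ} (h : IsSimpleSum (_root_.blockTensor T) r)
    (p q : I → Prop) [DecidablePred p] [DecidablePred q]
    (hpq : ∀ i, p i → ¬ q i)
    (hp : ∀ i, p i → ∃ L : Fin 2 → Matrix (C i) (R i) 𝕜, ∑ k, L k * T i k = 1) :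
    ∃ r', r = r' + ∑ i : {i // p i}, Fintype.card (C i) ∧
      IsSimpleSum (_root_.blockTensor fun i : {i // q i} => T i) r' := by
  choose L hL using fun i : {i // p i} => hp i i.2
  have h1 : IsSimpleSum (fun k => (_root_.blockTensor T k).submatrix
      (Sum.elim (fun x : (i : {i // p i}) × R i => (⟨x.1, x.2⟩ : (i : I) × R i))
        (fun x : (i : {i // q i}) × R i => ⟨x.1, x.2⟩)) id) r := h.submatrix _ _
  let F (k : Fin 2) : Matrix ((i : {i // p i}) × C i)
      (((i : {i // p i}) × R i) ⊕ ((i : {i // q i}) × R i)) 𝕜 :=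
    fromCols (blockDiagonal' fun i : {i // p i} => L i k) 0
  have hL' : ∑ k, F k *
      ((_root_.blockTensor T k).submatrix
        (Sum.elim (fun x : (i : {i // p i}) × R i => (⟨x.1, x.2⟩ : (i : I) × R i))
          (fun x : (i : {i // q i}) × R i => ⟨x.1, x.2⟩)) id).submatrix id
        (fun x : (i : {i // p i}) × C i => (⟨x.1, x.2⟩ : (i : I) × C i)) = 1 := by
    have key : ∀ (M : Matrix (((i : {i // p i}) × R i) ⊕ ((i : {i // q i}) × R i))
        ((i : {i // p i}) × C i) 𝕜) (k : Fin 2),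
        M.toRows₁ = blockDiagonal' (fun i : {i // p i} => T i k) →
        F k * M = blockDiagonal' fun i : {i // p i} => L i k * T i k := by
      intro M k hM
      conv_lhs => rw [← fromRows_toRows M]
      rw [fromCols_mul_fromRows, Matrix.zero_mul, add_zero, hM, blockDiagonal'_mul]
    rw [Fin.sum_univ_two, key _ 0, key _ 1, ← blockDiagonal'_add, ← blockDiagonal'_one]
    · congr 1
      ext1 i
      rw [Pi.one_apply, ← hL i, Fin.sum_univ_two]
      rfl
    all_goals
      ext ⟨i, a⟩ ⟨j, c⟩
      simp [blockDiagonal'_apply, Subtype.ext_iff]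
  have hz : ∀ (k : Fin 2) (x : (i : {i // q i}) × R i) (y : (i : {i // p i}) × C i),
      (_root_.blockTensor T k).submatrix
        (Sum.elim (fun x : (i : {i // p i}) × R i => (⟨x.1, x.2⟩ : (i : I) × R i))
          (fun x : (i : {i // q i}) × R i => ⟨x.1, x.2⟩)) id (Sum.inr x) ⟨y.1, y.2⟩ = 0 :=
    fun k x y => blockDiagonal'_apply_ne (fun i => T i k) x.2 y.2 fun e : x.1.1 = y.1.1 =>
      hpq y.1 y.1.2 (e ▸ x.1.2)
  obtain ⟨r', hr, h'⟩ := h1.exists_of_independent_columns _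
    (fun x : (i : {i // q i}) × C i => (⟨x.1, x.2⟩ : (i : I) × C i)) Sum.inr
    hz _ hL'
  refine ⟨r', by simpa using hr, ?_⟩
  convert h' using 2 with k
  ext ⟨i, a⟩ ⟨j, c⟩
  simp [blockDiagonal'_apply, Subtype.ext_iff]

end SimpleSums

/-! ### Rank and spectral defects of a square matrix -/

section SpectralDefect

variable {𝕜 : Type*} [Field 𝕜] {n : Type*} [Fintype n] [DecidableEq n]

/-- If `(M; E)` is a sum of `r` simple tensors, the space is spanned by vectors that are
eigenvectors of `M` modulo a subspace `Z` of dimension at most `r - n`. With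
`M = U * Da * V` and `1 = U * Db * V`, these are the columns of `U * Db`, and `Z` is the range of
`M * (U * Db) - U * Da`, which vanishes on the range of `V`. -/
theorem IsSimpleSum.exists_approximate_eigenvectors {M : Matrix n n 𝕜} {r : ℕ}
    (h : IsSimpleSum ![M, 1] r) :
    ∃ (Z : Submodule 𝕜 (n → 𝕜)) (u : Fin r → n → 𝕜) (μ : Fin r → 𝕜),
      Fintype.card n + Module.finrank 𝕜 Z ≤ r ∧ Submodule.span 𝕜 (Set.range u) = ⊤ ∧
      ∀ s, M *ᵥ u s - μ s • u s ∈ Z := by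
  obtain ⟨U, w, V, h⟩ := h
  have hM : M = U * diagonal (w 0) * V := h 0
  have h1 : 1 = U * diagonal (w 1) * V := h 1
  set G := M * (U * diagonal (w 1)) - U * diagonal (w 0) with hG
  have hGV : G * V = 0 := by
    rw [hG, Matrix.sub_mul, Matrix.mul_assoc M, ← h1, Matrix.mul_one, ← hM, sub_self]
  refine ⟨LinearMap.range G.mulVecLin, fun s i => (U * diagonal (w 1)) i s,
    fun s => w 0 s / w 1 s, ?_, ?_, ?_⟩
  · have hker : LinearMap.range V.mulVecLin ≤ LinearMap.ker G.mulVecLin := by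
      rintro _ ⟨x, rfl⟩
      simp [mulVec_mulVec, hGV]
    have hinj : Function.Injective V.mulVecLin := by
      intro x y hxy
      have := congrArg (fun z => (U * diagonal (w 1)) *ᵥ z) hxy
      simpa [mulVec_mulVec, ← Matrix.mul_assoc, ← h1] using this
    have e1 := LinearMap.finrank_range_add_finrank_ker G.mulVecLin
    have e2 := Submodule.finrank_mono hker
    rw [LinearMap.finrank_range_of_inj hinj, Module.finrank_fintype_fun_eq_card] at e2
    rw [Module.finrank_fintype_fun_eq_card, Fintype.card_fin] at e1
    omega
  · rw [eq_top_iff]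
    rintro x -
    have : x = (U * diagonal (w 1)) *ᵥ (V *ᵥ x) := by rw [mulVec_mulVec, ← h1, one_mulVec]
    rw [this, mulVec_eq_sum]
    refine Submodule.sum_mem _ fun s _ => ?_
    rw [op_smul_eq_smul]
    exact Submodule.smul_mem _ _ (Submodule.subset_span ⟨s, rfl⟩)
  · intro s
    by_cases hs : w 1 s = 0
    · -- the vector is zero, so the value `w 0 s / 0 = 0` does not matter
      have : (fun i => (U * diagonal (w 1)) i s) = 0 := by
        ext i
        simp [hs]
      simp only [this]
      simp
    · refine ⟨Pi.single s 1, ?_⟩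
      ext i
      simp only [mulVecLin_apply, mulVec_single_one, hG, col_apply, Matrix.sub_apply,
        Pi.sub_apply, mul_diagonal, Pi.smul_apply, smul_eq_mul]
      congr 1
      · simp [mul_apply (M := M), mulVec, dotProduct]
      · field_simp

/-- The rank exceeds the size `n` by at least the rank of `N`, when `N ^ 2 = 0`: in the notation of
`IsSimpleSum.exists_approximate_eigenvectors`, the range of `N` is contained in the kernel of `N` on
`Z + N Z`, whose dimension is at most that of `Z`. -/
theorem IsSimpleSum.card_add_rank_le {x : 𝕜} {N : Matrix n n 𝕜} (hN : N * N = 0) {r : ℕ}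
    (h : IsSimpleSum ![x • 1 + N, 1] r) : Fintype.card n + N.rank ≤ r := by
  obtain ⟨Z, u, μ, hZ, hspan, hu⟩ := h.exists_approximate_eigenvectors
  set f := N.mulVecLin with hf
  have hff : ∀ v, f (f v) = 0 := fun v => by simp [hf, mulVec_mulVec, hN]
  set S := Z ⊔ Z.map f
  have hrange : LinearMap.range f ≤ S := by
    rw [LinearMap.range_eq_map, ← hspan, Submodule.map_span, Submodule.span_le]
    rintro _ ⟨_, ⟨s, rfl⟩, rfl⟩
    -- `z = (N - ν) u` lies in `Z`
    have hz := hu s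
    set z := (x • 1 + N) *ᵥ u s - μ s • u s with hzdef
    have hz' : f (u s) = z + (μ s - x) • u s := by
      simp only [hzdef, hf, mulVecLin_apply, add_mulVec, smul_mulVec, one_mulVec, sub_smul]
      abel
    by_cases hν : μ s - x = 0
    · rw [hz', hν, zero_smul, add_zero]
      exact Submodule.mem_sup_left hz
    · have h2 : f z + (μ s - x) • f (u s) = 0 := by
        rw [← map_smul, ← map_add, ← hz', hff]
      have h3 : f (u s) = -(μ s - x)⁻¹ • f z := by
        rw [eq_neg_of_add_eq_zero_left h2, smul_neg, neg_smul, neg_neg, smul_smul,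
          inv_mul_cancel₀ hν, one_smul]
      rw [h3]
      exact Submodule.mem_sup_right (Submodule.smul_mem _ _ (Submodule.mem_map_of_mem hz))
  have hmap : S.map f ≤ Z.map f := by
    rw [Submodule.map_sup, sup_le_iff]
    refine ⟨le_rfl, ?_⟩
    rintro _ ⟨_, ⟨z, hz, rfl⟩, rfl⟩
    rw [hff]
    exact zero_mem _
  have hker : LinearMap.range f ≤ LinearMap.ker f := by
    rintro _ ⟨v, rfl⟩
    exact hff v
  have e1 : Module.finrank 𝕜 (S.map f) + Module.finrank 𝕜 (LinearMap.ker f ⊓ S : Submodule _ _) =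
      Module.finrank 𝕜 S := by
    have := LinearMap.finrank_range_add_finrank_ker (f.domRestrict S)
    rw [LinearMap.range_domRestrict, LinearMap.ker_domRestrict] at this
    rw [← this, inf_comm, ← Submodule.map_comap_subtype, Submodule.finrank_map_subtype_eq]
  have e2 : Module.finrank 𝕜 S ≤ Module.finrank 𝕜 Z + Module.finrank 𝕜 (Z.map f) :=
    Submodule.finrank_add_le_finrank_add_finrank _ _
  have e3 : N.rank ≤ Module.finrank 𝕜 (LinearMap.ker f ⊓ S : Submodule _ _) :=
    Submodule.finrank_mono (le_inf hker hrange)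
  have e4 : Module.finrank 𝕜 (Z.map f) ≤ Module.finrank 𝕜 (S.map f) :=
    Submodule.finrank_mono (Submodule.map_mono le_sup_left)
  omega

/-- When `N ^ 2 = d` with `d` not a square, no `N - ν` is singular, so the space is `Z + N Z`
in the notation of `IsSimpleSum.exists_approximate_eigenvectors`. -/
theorem IsSimpleSum.three_mul_card_le {x d : 𝕜} {N : Matrix n n 𝕜} (hN : N * N = d • 1)
    (hd : ∀ y : 𝕜, y * y ≠ d) {r : ℕ} (h : IsSimpleSum ![x • 1 + N, 1] r) :
    3 * Fintype.card n ≤ 2 * r := by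
  obtain ⟨Z, u, μ, hZ, hspan, hu⟩ := h.exists_approximate_eigenvectors
  set f := N.mulVecLin with hf
  have hff : ∀ v, f (f v) = d • v := fun v => by simp [hf, mulVec_mulVec, hN, smul_mulVec]
  have htop : Z ⊔ Z.map f = ⊤ := by
    rw [eq_top_iff, ← hspan, Submodule.span_le]
    rintro _ ⟨s, rfl⟩
    have hz := hu s
    set z := (x • 1 + N) *ᵥ u s - μ s • u s with hzdef
    set ν := μ s - x with hν
    have hz' : z = f (u s) - ν • u s := by
      simp only [hzdef, hf, mulVecLin_apply, add_mulVec, smul_mulVec, one_mulVec, hν, sub_smul]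
      abel
    -- `(N + ν) (N - ν) = d - ν ^ 2`
    have h2 : ν • z + f z = (d - ν * ν) • u s := by
      rw [hz', map_sub, hff, map_smul]
      module
    have h3 : u s = (d - ν * ν)⁻¹ • (ν • z + f z) := by
      rw [h2, smul_smul, inv_mul_cancel₀ (sub_ne_zero.2 (hd ν).symm), one_smul]
    rw [h3]
    exact Submodule.smul_mem _ _ (Submodule.add_mem_sup (Submodule.smul_mem _ _ hz)
      (Submodule.mem_map_of_mem hz))
  have e2 := Submodule.finrank_add_le_finrank_add_finrank Z (Z.map f)
  have e3 := Submodule.finrank_map_le f Z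
  rw [htop, finrank_top, Module.finrank_fintype_fun_eq_card] at e2
  omega

end SpectralDefect

/-! ### The lower bound for Jordan blocks with a common eigenvalue -/

section LowerBound

variable {𝕜 : Type*} [Field 𝕜]

theorem IsSimpleSum.blockTensor_comp {I I' : Type*} [DecidableEq I] [DecidableEq I']
    {R C : I → Type*} {T : ∀ i, Fin 2 → Matrix (R i) (C i) 𝕜} {r : ℕ}
    (h : IsSimpleSum (_root_.blockTensor T) r) {g : I' → I} (hg : Function.Injective g) :
    IsSimpleSum (_root_.blockTensor fun i => T (g i)) r := by
  convert h.submatrix (fun x : (i : I') × R (g i) => (⟨g x.1, x.2⟩ : (i : I) × R i))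
    (fun x : (i : I') × C (g i) => (⟨g x.1, x.2⟩ : (i : I) × C i)) using 2 with k
  ext ⟨i, a⟩ ⟨j, c⟩
  by_cases hij : i = j
  · subst hij
    simp only [_root_.blockTensor, submatrix_apply, blockDiagonal'_apply_eq]
  · simp only [_root_.blockTensor, submatrix_apply, blockDiagonal'_apply_ne _ _ _ hij,
      blockDiagonal'_apply_ne _ _ _ (hg.ne hij)]

/-- The substitution method applied to all but the last two columns of the blocks of a block upper
triangular matrix. -/
theorem IsSimpleSum.exists_fromBlocks {I : Type*} [Fintype I] [DecidableEq I] {s : I → ℕ}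
    (hs : ∀ i, 2 ≤ s i) {M : ∀ i, Matrix (Fin (s i)) (Fin (s i)) 𝕜}
    (hM : ∀ i (a b : Fin (s i)), s i - 2 ≤ (a : ℕ) → (b : ℕ) < s i - 2 → M i a b = 0) {r : ℕ}
    (h : IsSimpleSum ![blockDiagonal' M, 1] r) {p q : ∀ i, Fin (s i)}
    (hp : ∀ i, (p i : ℕ) = s i - 2) (hq : ∀ i, (q i : ℕ) = s i - 1) :
    ∃ r', r = r' + ∑ i, (s i - 2) ∧
      IsSimpleSum ![fromBlocks (diagonal fun i => M i (p i) (p i))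
        (diagonal fun i => M i (p i) (q i)) (diagonal fun i => M i (q i) (p i))
        (diagonal fun i => M i (q i) (q i)), 1] r' := by
  let j₁ : ((i : I) × Fin (s i - 2)) → (i : I) × Fin (s i) :=
    fun x => ⟨x.1, x.2.castLE (Nat.sub_le _ _)⟩
  have hj₁ : Function.Injective j₁ := by
    rintro ⟨i, a⟩ ⟨j, b⟩ hab
    obtain ⟨h1, h2⟩ := Sigma.mk.inj_iff.1 hab
    change i = j at h1
    subst h1
    exact congrArg _ (Fin.castLE_injective _ (eq_of_heq h2))
  let ρ : I ⊕ I → (i : I) × Fin (s i) := Sum.elim (fun i => ⟨i, p i⟩) fun i => ⟨i, q i⟩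
  have hρval : ∀ x, (ρ x).1 = Sum.elim id id x ∧ s (ρ x).1 - 2 ≤ ((ρ x).2 : ℕ) := by
    rintro (i | i)
    · exact ⟨rfl, (hp i).ge⟩
    · exact ⟨rfl, by have := hq i; simp only [ρ, Sum.elim_inr]; omega⟩
  have hpq : ∀ i, p i ≠ q i := fun i e => by
    have := hp i
    have := hq i
    have := hs i
    rw [e] at *
    omega
  have hρ : Function.Injective ρ := by
    rintro (i | i) (j | j) hij <;> obtain ⟨h1, h2⟩ := Sigma.mk.inj_iff.1 hij <;>
      change i = j at h1 <;> subst h1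
    · rfl
    · exact absurd (eq_of_heq h2) (hpq i)
    · exact absurd (eq_of_heq h2).symm (hpq i)
    · rfl
  have hzero : ∀ (k : Fin 2) x y, (![blockDiagonal' M, 1] : Fin 2 → Matrix _ _ 𝕜) k (ρ x) (j₁ y) =
      0 := by
    intro k x y
    have hx := (hρval x).2
    generalize ρ x = z at hx
    obtain ⟨j, b⟩ := y
    obtain ⟨i, a⟩ := z
    fin_cases k
    · by_cases hij : i = j
      · subst hij
        exact (blockDiagonal'_apply_eq _ _ _ _).trans (hM i _ _ hx b.2)
      · exact blockDiagonal'_apply_ne _ _ _ hij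
    · refine one_apply_ne fun e => ?_
      obtain ⟨rfl, h2⟩ := Sigma.mk.inj_iff.1 e
      have := b.2
      have := congrArg Fin.val (eq_of_heq h2)
      simp at this hx
      omega
  obtain ⟨r', hr, h'⟩ := h.exists_of_independent_columns j₁ ρ ρ hzero
    ![0, (1 : Matrix _ _ 𝕜).submatrix j₁ id] (by
      rw [Fin.sum_univ_two]
      simp only [cons_val_zero, cons_val_one, Matrix.zero_mul, zero_add]
      rw [← submatrix_mul _ _ _ _ _ Function.bijective_id, Matrix.one_mul, submatrix_one _ hj₁])
  refine ⟨r', by simpa using hr, ?_⟩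
  convert h' using 2 with k
  fin_cases k
  · ext (i | i) (j | j) <;> by_cases hij : i = j
    all_goals first
      | subst hij; simp [ρ, blockDiagonal'_apply_eq]
      | simp [ρ, hij, blockDiagonal'_apply_ne]
  · exact (submatrix_one _ hρ).symm

/-- Jordan blocks with the same eigenvalue: the substitution method leaves only the last two rows
and columns of each block, which form `(x E + N; E)` with `N ^ 2 = 0` and `N` of rank the number of
blocks. -/
theorem le_of_isSimpleSum_jordan {I : Type*} [Fintype I] [DecidableEq I] {s : I → ℕ}
    (hs : ∀ i, 2 ≤ s i) (x : 𝕜) {r : ℕ}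
    (h : IsSimpleSum ![blockDiagonal' fun i => x • 1 + nilJordan 𝕜 (s i), 1] r) :
    ∑ i, s i + Fintype.card I ≤ r := by
  obtain ⟨r', hr, h'⟩ := h.exists_fromBlocks hs (fun i a b ha hb => by
      have h1 : a ≠ b := fun e => by rw [e] at ha; omega
      have h2 : (a : ℕ) + 1 ≠ b := by omega
      simp [nilJordan, one_apply_ne h1, h2]) (p := fun i => ⟨s i - 2, by have := hs i; omega⟩)
    (q := fun i => ⟨s i - 1, by have := hs i; omega⟩) (fun _ => rfl) fun _ => rfl
  have hN : (fromBlocks 0 1 0 0 : Matrix (I ⊕ I) (I ⊕ I) 𝕜) * fromBlocks 0 1 0 0 = 0 := by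
    simp [fromBlocks_multiply]
  have hrank : Fintype.card I ≤ (fromBlocks 0 1 0 0 : Matrix (I ⊕ I) (I ⊕ I) 𝕜).rank := by
    have := rank_submatrix_le (fromBlocks 0 1 0 0 : Matrix (I ⊕ I) (I ⊕ I) 𝕜) Sum.inl Sum.inr
    rwa [show (fromBlocks 0 1 0 0 : Matrix (I ⊕ I) (I ⊕ I) 𝕜).submatrix Sum.inl Sum.inr = 1 from
      toBlocks_fromBlocks₁₂ _ _ _ _, rank_one] at this
  have h2 : IsSimpleSum ![x • 1 + (fromBlocks 0 1 0 0 : Matrix (I ⊕ I) (I ⊕ I) 𝕜), 1] r' := by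
    convert h' using 2
    rw [← fromBlocks_one, fromBlocks_smul, fromBlocks_add, fromBlocks_inj]
    have e1 : ∀ i, s i - 2 ≠ s i - 1 := fun i => by have := hs i; omega
    have e2 : ∀ i, s i - 2 + 1 = s i - 1 := fun i => by have := hs i; omega
    have e3 : ∀ i, s i - 1 + 1 ≠ s i - 2 := fun i => by omega
    refine ⟨?_, ?_, ?_, ?_⟩ <;> ext i j <;> by_cases hij : i = j <;>
      simp [nilJordan, hij, one_apply, e1, e2, e3, (e1 _).symm]
  have h3 := h2.card_add_rank_le hN
  rw [Fintype.card_sum] at h3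
  have h4 : ∑ i, s i = ∑ i, (s i - 2) + 2 * Fintype.card I := by
    rw [mul_comm, ← smul_eq_mul (Fintype.card I), ← Finset.card_univ, ← Finset.sum_const,
      ← Finset.sum_add_distrib]
    exact Finset.sum_congr rfl fun i _ => by have := hs i; omega
  omega

open scoped Kronecker in
/-- The first slice `E_k ⊗ C + J_k ⊗ E_2` of a block of type C, where `C` is the `2 × 2` matrix
with parameters `c` and `t`. -/
def rotJordan (c t : 𝕜) (k : ℕ) : Matrix (Fin (k * 2)) (Fin (k * 2)) 𝕜 :=
  ((1 : Matrix (Fin k) (Fin k) 𝕜) ⊗ₖ !![c, -t; t, c] +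
    nilJordan 𝕜 k ⊗ₖ (1 : Matrix (Fin 2) (Fin 2) 𝕜)).submatrix
      finProdFinEquiv.symm finProdFinEquiv.symm

theorem rotJordan_apply (c t : 𝕜) (k : ℕ) (a b : Fin (k * 2)) :
    rotJordan c t k a b =
      (if (a : ℕ) / 2 = (b : ℕ) / 2 then
        !![c, -t; t, c] (finProdFinEquiv.symm a).2 (finProdFinEquiv.symm b).2 else 0) +
      if (a : ℕ) / 2 + 1 = (b : ℕ) / 2 ∧ (a : ℕ) % 2 = (b : ℕ) % 2 then 1 else 0 := by
  simp only [rotJordan, submatrix_apply, Matrix.add_apply,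
    kroneckerMap_apply, one_apply, nilJordan, of_apply, ite_mul, one_mul, zero_mul, Fin.ext_iff,
    ite_and]
  rfl

/-- Blocks of type C with the same pair of eigenvalues: the substitution method leaves only the last
two rows and columns of each block, which form `(c E + N; E)` with `N ^ 2 = d`, not a square. -/
theorem le_of_isSimpleSum_rotJordan {I : Type*} [Fintype I] [DecidableEq I] {s : I → ℕ}
    (hs : ∀ i, 1 ≤ s i) (c d : 𝕜) (t : I → 𝕜) (ht : ∀ i, t i * t i = -d)
    (hd : ∀ y : 𝕜, y * y ≠ d) {r : ℕ}
    (h : IsSimpleSum ![blockDiagonal' fun i => rotJordan c (t i) (s i), 1] r) :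
    ∑ i, s i * 2 + Fintype.card I ≤ r := by
  obtain ⟨r', hr, h'⟩ := h.exists_fromBlocks (s := fun i => s i * 2)
    (fun i => by have := hs i; omega) (fun i a b ha hb => by
      have h1 : (a : ℕ) / 2 ≠ (b : ℕ) / 2 := by omega
      have h2 : ¬((a : ℕ) / 2 + 1 = (b : ℕ) / 2 ∧ (a : ℕ) % 2 = (b : ℕ) % 2) := by omega
      rw [rotJordan_apply, if_neg h1, if_neg h2, add_zero])
    (p := fun i => finProdFinEquiv (⟨s i - 1, by have := hs i; omega⟩, 0))
    (q := fun i => finProdFinEquiv (⟨s i - 1, by have := hs i; omega⟩, 1))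
    (fun i => by have := hs i; simp; omega) (fun i => by have := hs i; simp; omega)
  have hN : (fromBlocks 0 (-diagonal t) (diagonal t) 0 : Matrix (I ⊕ I) (I ⊕ I) 𝕜) *
      fromBlocks 0 (-diagonal t) (diagonal t) 0 = d • 1 := by
    rw [fromBlocks_multiply, ← fromBlocks_one, fromBlocks_smul]
    simp [ht, smul_one_eq_diagonal]
  have h2 : IsSimpleSum ![c • 1 + fromBlocks 0 (-diagonal t) (diagonal t) 0, 1] r' := by
    convert h' using 2
    rw [← fromBlocks_one, fromBlocks_smul, fromBlocks_add, fromBlocks_inj]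
    refine ⟨?_, ?_, ?_, ?_⟩ <;> ext i j <;> by_cases hij : i = j <;>
      simp [rotJordan, nilJordan, hij, one_apply]
  have h3 := h2.three_mul_card_le hN hd
  rw [Fintype.card_sum] at h3
  have h4 : ∑ i, s i * 2 = ∑ i, (s i * 2 - 2) + 2 * Fintype.card I := by
    rw [mul_comm, ← smul_eq_mul (Fintype.card I), ← Finset.card_univ, ← Finset.sum_const,
      ← Finset.sum_add_distrib]
    exact Finset.sum_congr rfl fun i _ => by have := hs i; omega
  omega

namespace KroneckerBlock

/-- The contribution of a block to the rank, apart from the maximum `kroneckerAlpha`. -/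
def baseRank : KroneckerBlock 𝕜 → ℕ
  | typeA _ _ => 0
  | typeB _ k => k
  | typeC _ _ k => k * 2
  | typeD k => k
  | typeE k => k + 1
  | typeF k => k + 1

/-- The columns of a block of type E are linearly independent: `(E_k, 0)` has a left inverse up to
the last column, which is the last basis vector in `(0, E_k)`. -/
theorem typeE_left_inverse {k : ℕ} (hk : 1 ≤ k) :
    ∃ L : Fin 2 → Matrix (Fin (k + 1)) (Fin k) 𝕜,
      L 0 * zeroId 𝕜 k + L 1 * idZero 𝕜 k = 1 := by
  refine ⟨![of fun j i => if j = Fin.last k ∧ (i : ℕ) + 1 = k then 1 else 0, (idZero 𝕜 k)ᵀ], ?_⟩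
  ext j j'
  simp only [cons_val_zero, cons_val_one, Matrix.add_apply, mul_apply, of_apply, transpose_apply,
    idZero, zeroId, ite_mul, one_mul, zero_mul]
  induction j using Fin.lastCases with
  | last =>
    rw [Finset.sum_eq_single ⟨k - 1, by omega⟩, Finset.sum_eq_zero]
    · simp [one_apply, Fin.ext_iff, Nat.sub_add_cancel hk]
    · intro i _
      simp [i.2.ne]
    · intro i _ hi
      simp only [ne_eq, Fin.ext_iff] at hi
      simp; omega
    · simp
  | cast j =>
    rw [Finset.sum_eq_zero, Finset.sum_eq_single j]
    · simp [one_apply, Fin.ext_iff]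
    · intro i _ hi
      rw [ne_eq, Fin.ext_iff] at hi
      simp [hi]
    · simp
    · intro i _
      simp [Fin.ext_iff, j.2.ne]

end KroneckerBlock

end LowerBound

/-! ### The lower bound for the rank -/

section KroneckerLowerBound

variable {𝕜 : Type*} [RCLike 𝕜]

namespace KroneckerBlock

/-- Blocks of type B, C, D, E have independent columns. -/
theorem exists_left_inverse {b : KroneckerBlock 𝕜} (hb : b.Admissible)
    (hA : ∀ k l, b ≠ typeA k l) (hF : ∀ k, b ≠ typeF k) :
    ∃ L : Fin 2 → Matrix (Fin b.cols) (Fin b.rows) 𝕜, ∑ k, L k * b.tensor k = 1 := by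
  simp only [Fin.sum_univ_two]
  have key : ∀ (n : ℕ) (M : Matrix (Fin n) (Fin n) 𝕜), 0 * M + 1 * 1 = 1 := by simp
  cases b with
  | typeA k l => exact absurd rfl (hA k l)
  | typeB x k =>
    exact ⟨(![0, 1] : Fin 2 → Matrix (Fin k) (Fin k) 𝕜), key _ _⟩
  | typeC c s k =>
    exact ⟨(![0, 1] : Fin 2 → Matrix (Fin (k * 2)) (Fin (k * 2)) 𝕜), key _ _⟩
  | typeD k =>
    exact ⟨(![1, 0] : Fin 2 → Matrix (Fin k) (Fin k) 𝕜), (add_comm _ _).trans (key k _)⟩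
  | typeE k => exact typeE_left_inverse hb
  | typeF k => exact absurd rfl (hF k)

/-- Blocks of type F have independent rows. -/
theorem exists_left_inverse_transpose {b : KroneckerBlock 𝕜} (hb : b.Admissible)
    (hF : ∃ k, b = typeF k) :
    ∃ L : Fin 2 → Matrix (Fin b.rows) (Fin b.cols) 𝕜, ∑ k, L k * (b.tensor k)ᵀ = 1 := by
  obtain ⟨k, rfl⟩ := hF
  simp only [Fin.sum_univ_two]
  exact typeE_left_inverse hb

end KroneckerBlock

theorem sum_subtype_eq_sum_ite {I : Type*} [Fintype I] (p : I → Prop) [DecidablePred p]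
    (f : I → ℕ) : ∑ i : {i // p i}, f i = ∑ i, if p i then f i else 0 := by
  rw [← Finset.sum_filter]
  exact (Finset.sum_subtype _ (by simp) f).symm

theorem card_subtype_eq_ncard {I : Type*} [Fintype I] (p : I → Prop) [DecidablePred p] :
    Fintype.card {i // p i} = {i | p i}.ncard := by
  rw [← Nat.card_coe_set_eq, Nat.card_eq_fintype_card]
  exact Fintype.card_congr (Equiv.refl _)

/-- A lower bound for the rank of a subfamily of the blocks that exceeds its base rank by the number
of its blocks extends to the whole canonical form: the rows of the blocks of type F and the columns
of the other blocks outside of the subfamily can be peeled off. -/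
theorem sum_baseRank_add_card_le {r N : ℕ} {b : Fin r → KroneckerBlock 𝕜}
    (hb : ∀ i, (b i).Admissible) (q : Fin r → Prop) [DecidablePred q]
    (hq : ∀ i, q i → (∀ k, b i ≠ .typeF k) ∧ ∀ k l, b i ≠ .typeA k l)
    (hsub : ∀ N' (β : {i // q i} → KroneckerBlock 𝕜), (∀ i, β i = b i) →
      IsSimpleSum (blockTensor fun i => (β i).tensor) N' →
      ∑ i, (β i).baseRank + Fintype.card {i // q i} ≤ N')
    (h : IsSimpleSum (blockTensor fun i => (b i).tensor) N) :
    ∑ i, (b i).baseRank + Fintype.card {i // q i} ≤ N := by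
  classical
  have h1 : IsSimpleSum (blockTensor fun i k => ((b i).tensor k)ᵀ) N := by
    convert h.transpose using 2 with k
    rw [blockTensor, blockDiagonal'_transpose]
  -- remove the blocks of type F by rows, then the blocks outside of the subfamily by columns
  obtain ⟨N₁, hN₁, h2⟩ := h1.peel_columns (fun i => ∃ k, b i = .typeF k)
    (fun i => ¬∃ k, b i = .typeF k) (fun _ h h' => h' h)
    fun i hi => KroneckerBlock.exists_left_inverse_transpose (hb i) hi
  have h3 : IsSimpleSum
      (blockTensor fun i : {i // ¬∃ k, b i = .typeF k} => (b i).tensor) N₁ := by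
    convert h2.transpose using 2 with k
    rw [blockTensor, blockTensor, blockDiagonal'_transpose]
    rfl
  obtain ⟨N₂, hN₂, h4⟩ := h3.peel_columns (fun i => ¬q i ∧ ∀ k l, b i ≠ .typeA k l)
    (fun i => q i) (fun _ h => h.1)
    fun i hi => KroneckerBlock.exists_left_inverse (hb i) hi.2 (by simpa using i.2)
  have h5 := h4.blockTensor_comp (I' := {i // q i})
    (g := fun i => ⟨⟨i, fun ⟨k, hk⟩ => (hq i i.2).1 k hk⟩, i.2⟩)
    (fun i j hij => by simpa [Subtype.ext_iff] using hij)
  have h6 := hsub _ _ (fun _ => rfl) h5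
  simp only [Fintype.card_fin] at hN₁ hN₂
  rw [sum_subtype_eq_sum_ite _ fun i => (b i).rows] at hN₁
  rw [sum_subtype_eq_sum_ite _ fun i : {i // ¬∃ k, b i = .typeF k} => (b i).cols,
    sum_subtype_eq_sum_ite _ fun i => if ¬q i ∧ ∀ k l, b i ≠ .typeA k l then (b i).cols else 0]
    at hN₂
  rw [sum_subtype_eq_sum_ite q fun i => (b i).baseRank] at h6
  have h7 : ∑ i, (b i).baseRank = (∑ i, if ∃ k, b i = .typeF k then (b i).rows else 0) +
      (∑ i, if ¬∃ k, b i = .typeF k then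
        if ¬q i ∧ ∀ k l, b i ≠ .typeA k l then (b i).cols else 0 else 0) +
      ∑ i, if q i then (b i).baseRank else 0 := by
    rw [← Finset.sum_add_distrib, ← Finset.sum_add_distrib]
    refine Finset.sum_congr rfl fun i _ => ?_
    by_cases hqi : q i
    · have hi := hq i hqi
      simp [hqi, hi]
    · cases hbi : b i <;>
        simp [hqi, KroneckerBlock.baseRank, KroneckerBlock.rows, KroneckerBlock.cols]
  omega

theorem sum_baseRank_add_countB_le {r N : ℕ} {b : Fin r → KroneckerBlock 𝕜}
    (hb : ∀ i, (b i).Admissible) (h : IsSimpleSum (blockTensor fun i => (b i).tensor) N) (x : 𝕜) :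
    ∑ i, (b i).baseRank + countB b x ≤ N := by
  classical
  rw [countB, ← card_subtype_eq_ncard]
  refine sum_baseRank_add_card_le hb (fun i => ∃ k, 2 ≤ k ∧ b i = .typeB x k)
    (fun i ⟨k, _, hk⟩ => by simp [hk]) (fun N' β hβ h' => ?_) h
  choose k hk hbk using fun i : {i // ∃ k, 2 ≤ k ∧ b i = .typeB x k} => i.2
  obtain rfl : β = fun i => .typeB x (k i) := funext fun i => (hβ i).trans (hbk i)
  refine le_of_isSimpleSum_jordan hk x ?_
  have h'' : IsSimpleSum (fun j => blockDiagonal' fun i =>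
      (![x • 1 + nilJordan 𝕜 (k i), 1] : Fin 2 → Matrix (Fin (k i)) (Fin (k i)) 𝕜) j) N' := h'
  convert h'' using 1
  funext j
  fin_cases j
  · rfl
  · exact blockDiagonal'_one.symm

theorem sum_baseRank_add_countD_le {r N : ℕ} {b : Fin r → KroneckerBlock 𝕜}
    (hb : ∀ i, (b i).Admissible) (h : IsSimpleSum (blockTensor fun i => (b i).tensor) N) :
    ∑ i, (b i).baseRank + countD b ≤ N := by
  classical
  rw [countD, ← card_subtype_eq_ncard]
  refine sum_baseRank_add_card_le hb (fun i => ∃ k, 2 ≤ k ∧ b i = .typeD k)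
    (fun i ⟨k, _, hk⟩ => by simp [hk]) (fun N' β hβ h' => ?_) h
  choose k hk hbk using fun i : {i // ∃ k, 2 ≤ k ∧ b i = .typeD k} => i.2
  obtain rfl : β = fun i => .typeD (k i) := funext fun i => (hβ i).trans (hbk i)
  refine le_of_isSimpleSum_jordan hk (0 : 𝕜) ?_
  simp only [zero_smul, zero_add]
  refine IsSimpleSum.swap ?_
  have h'' : IsSimpleSum (fun j => blockDiagonal' fun i =>
      (![1, nilJordan 𝕜 (k i)] : Fin 2 → Matrix (Fin (k i)) (Fin (k i)) 𝕜) j) N' := h'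
  convert h'' using 1
  funext j
  fin_cases j
  · exact blockDiagonal'_one.symm
  · rfl

/-- A sum of two squares vanishes only trivially if `𝕜` is the real field, which is what
`RCLike.I = 0` says. -/
theorem RCLike.eq_zero_of_mul_self_add_mul_self (hI : (RCLike.I : 𝕜) = 0) {y z : 𝕜}
    (h : y * y + z * z = 0) : z = 0 := by
  have hre : ∀ w : 𝕜, ((RCLike.re w : ℝ) : 𝕜) = w := fun w => by
    conv_rhs => rw [← RCLike.re_add_im w, hI, mul_zero, add_zero]
  rw [← hre y, ← hre z] at h
  norm_cast at h
  rw [← hre z, (mul_self_add_mul_self_eq_zero.1 h).2, RCLike.ofReal_zero]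

theorem sum_baseRank_add_countC_le {r N : ℕ} {b : Fin r → KroneckerBlock 𝕜}
    (hb : ∀ i, (b i).Admissible) (h : IsSimpleSum (blockTensor fun i => (b i).tensor) N)
    (c s : 𝕜) : ∑ i, (b i).baseRank + countC b c s ≤ N := by
  classical
  rw [countC, ← card_subtype_eq_ncard]
  refine sum_baseRank_add_card_le hb
    (fun i => ∃ t k, (t = s ∨ t = -s) ∧ 1 ≤ k ∧ b i = .typeC c t k)
    (fun i ⟨t, k, _, _, hk⟩ => by simp [hk]) (fun N' β hβ h' => ?_) h
  by_cases hne : IsEmpty {i // ∃ t k, (t = s ∨ t = -s) ∧ 1 ≤ k ∧ b i = .typeC c t k}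
  · rw [Finset.univ_eq_empty, Finset.sum_empty, Fintype.card_eq_zero]
    exact Nat.zero_le _
  obtain ⟨i₀, t₀, k₀, ht₀, -, h₀⟩ := not_isEmpty_iff.1 hne
  have hadm := hb i₀
  rw [h₀] at hadm
  have hs : s ≠ 0 := fun e => hadm.2.1 (by simpa [e] using ht₀)
  choose t k ht hk hbk using
    fun i : {i // ∃ t k, (t = s ∨ t = -s) ∧ 1 ≤ k ∧ b i = .typeC c t k} => i.2
  obtain rfl : β = fun i => .typeC c (t i) (k i) := funext fun i => (hβ i).trans (hbk i)
  refine le_of_isSimpleSum_rotJordan hk c (-(s * s)) t (fun i => ?_) (fun y hy => hs ?_) ?_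
  · rcases ht i with e | e <;> simp [e]
  · exact RCLike.eq_zero_of_mul_self_add_mul_self hadm.1 (y := y) (by rw [hy]; ring)
  have h'' : IsSimpleSum (fun j => blockDiagonal' fun i =>
      (![rotJordan c (t i) (k i), 1] : Fin 2 → Matrix (Fin (k i * 2)) (Fin (k i * 2)) 𝕜) j) N' := h'
  convert h'' using 1
  funext j
  fin_cases j
  · rfl
  · exact blockDiagonal'_one.symm

/-- The lower bound for the rank of a Kronecker canonical form. -/
theorem sum_baseRank_add_kroneckerAlpha_le {r N : ℕ} {b : Fin r → KroneckerBlock 𝕜}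
    (hb : ∀ i, (b i).Admissible) (h : IsSimpleSum (blockTensor fun i => (b i).tensor) N) :
    ∑ i, (b i).baseRank + kroneckerAlpha b ≤ N := by
  have h0 := sum_baseRank_add_countD_le hb h
  have h1 : (⨆ x : 𝕜, countB b x) ≤ N - ∑ i, (b i).baseRank :=
    ciSup_le fun x => Nat.le_sub_of_add_le' (sum_baseRank_add_countB_le hb h x)
  have h2 : (⨆ p : 𝕜 × 𝕜, countC b p.1 p.2) ≤ N - ∑ i, (b i).baseRank :=
    ciSup_le fun p => Nat.le_sub_of_add_le' (sum_baseRank_add_countC_le hb h p.1 p.2)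
  have h3 : kroneckerAlpha b ≤ N - ∑ i, (b i).baseRank :=
    max_le h1 (max_le (Nat.le_sub_of_add_le' h0) h2)
  omega

end KroneckerLowerBound

/-! ### Tensors that are diagonal up to a few simple tensors -/

section DiagonalUpTo

variable {𝕜 : Type*} [Field 𝕜] {ι κ ι' κ' : Type*} [Fintype ι] [Fintype κ] [Fintype ι'] [Fintype κ']

/-- `T` is a sum of two tensors: a sum of `d` simple tensors `u s ⊗ v s ⊗ w s` with linearly
independent `u` and linearly independent `v`, and a sum of `p` simple tensors. Independence is
encoded by one-sided inverses of the matrices with columns `u s` and with rows `v s`. -/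
def IsDiagonalUpTo (T : Fin 2 → Matrix ι κ 𝕜) (d p : ℕ) : Prop :=
  ∃ (U : Matrix ι (Fin d) 𝕜) (w : Fin 2 → Fin d → 𝕜) (V : Matrix (Fin d) κ 𝕜)
    (U' : Matrix (Fin d) ι 𝕜) (V' : Matrix κ (Fin d) 𝕜),
    U' * U = 1 ∧ V * V' = 1 ∧ IsSimpleSum (fun k => T k - U * diagonal (w k) * V) p

theorem IsDiagonalUpTo.of_fintype {σ : Type*} [Fintype σ] [DecidableEq σ]
    {T : Fin 2 → Matrix ι κ 𝕜} {d p : ℕ} (hd : Fintype.card σ = d)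
    (U : Matrix ι σ 𝕜) (w : Fin 2 → σ → 𝕜) (V : Matrix σ κ 𝕜) (U' : Matrix σ ι 𝕜)
    (V' : Matrix κ σ 𝕜) (hU : U' * U = 1) (hV : V * V' = 1)
    (h : IsSimpleSum (fun k => T k - U * diagonal (w k) * V) p) : IsDiagonalUpTo T d p := by
  let e := Fintype.equivFinOfCardEq hd
  refine ⟨U.submatrix id e.symm, fun k => w k ∘ e.symm, V.submatrix e.symm id,
    U'.submatrix e.symm id, V'.submatrix id e.symm, ?_, ?_, ?_⟩
  · rw [← submatrix_mul _ _ _ _ _ Function.bijective_id, hU, submatrix_one_equiv]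
  · rw [← submatrix_mul _ _ _ _ _ Function.bijective_id, hV, submatrix_one_equiv]
  · simp_rw [← submatrix_diagonal_equiv, submatrix_mul_equiv, submatrix_id_id]
    exact h

theorem IsDiagonalUpTo.mono {T : Fin 2 → Matrix ι κ 𝕜} {d p q : ℕ} (h : IsDiagonalUpTo T d p)
    (hpq : p ≤ q) : IsDiagonalUpTo T d q := by
  obtain ⟨U, w, V, U', V', hU, hV, h⟩ := h
  exact ⟨U, w, V, U', V', hU, hV, h.mono hpq⟩

theorem IsDiagonalUpTo.mul [DecidableEq ι] [DecidableEq κ] {T : Fin 2 → Matrix ι κ 𝕜} {d p : ℕ}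
    (h : IsDiagonalUpTo T d p) {P : Matrix ι' ι 𝕜} {P' : Matrix ι ι' 𝕜} {Q : Matrix κ κ' 𝕜}
    {Q' : Matrix κ' κ 𝕜} (hP : P' * P = 1) (hQ : Q * Q' = 1) :
    IsDiagonalUpTo (fun k => P * T k * Q) d p := by
  obtain ⟨U, w, V, U', V', hU, hV, h⟩ := h
  refine ⟨P * U, w, V * Q, U' * P', Q' * V', ?_, ?_, ?_⟩
  · rw [Matrix.mul_assoc, ← Matrix.mul_assoc P', hP, Matrix.one_mul, hU]
  · rw [Matrix.mul_assoc, ← Matrix.mul_assoc Q, hQ, Matrix.one_mul, hV]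
  · convert h.mul P Q using 2 with k
    simp only [Matrix.mul_sub, Matrix.sub_mul, Matrix.mul_assoc]

theorem IsDiagonalUpTo.submatrix {T : Fin 2 → Matrix ι κ 𝕜} {d p : ℕ}
    (h : IsDiagonalUpTo T d p) (e : ι' ≃ ι) (f : κ' ≃ κ) :
    IsDiagonalUpTo (fun k => (T k).submatrix e f) d p := by
  obtain ⟨U, w, V, U', V', hU, hV, h⟩ := h
  refine ⟨U.submatrix e id, w, V.submatrix id f, U'.submatrix id e, V'.submatrix f id, ?_, ?_, ?_⟩
  · rw [submatrix_mul_equiv, hU, submatrix_id_id]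
  · rw [submatrix_mul_equiv, hV, submatrix_id_id]
  · exact h.submatrix e f

theorem IsDiagonalUpTo.transpose {T : Fin 2 → Matrix ι κ 𝕜} {d p : ℕ}
    (h : IsDiagonalUpTo T d p) : IsDiagonalUpTo (fun k => (T k)ᵀ) d p := by
  obtain ⟨U, w, V, U', V', hU, hV, h⟩ := h
  refine ⟨Vᵀ, w, Uᵀ, V'ᵀ, U'ᵀ, ?_, ?_, ?_⟩
  · rw [← transpose_mul, hV, transpose_one]
  · rw [← transpose_mul, hU, transpose_one]
  · convert h.transpose using 2 with k
    simp [Matrix.mul_assoc]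

theorem IsDiagonalUpTo.blockTensor {I : Type*} [Fintype I] [DecidableEq I] {R C : I → Type*}
    [∀ i, Fintype (R i)] [∀ i, Fintype (C i)] {T : ∀ i, Fin 2 → Matrix (R i) (C i) 𝕜}
    {d p : I → ℕ} (h : ∀ i, IsDiagonalUpTo (T i) (d i) (p i)) :
    IsDiagonalUpTo (_root_.blockTensor T) (∑ i, d i) (∑ i, p i) := by
  choose U w V U' V' hU hV h using h
  refine .of_fintype (σ := (i : I) × Fin (d i)) (by simp) (blockDiagonal' U)
    (fun k x => w x.1 k x.2) (blockDiagonal' V) (blockDiagonal' U') (blockDiagonal' V') ?_ ?_ ?_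
  · rw [← blockDiagonal'_mul, ← blockDiagonal'_one]
    exact congrArg _ (funext hU)
  · rw [← blockDiagonal'_mul, ← blockDiagonal'_one]
    exact congrArg _ (funext hV)
  · convert IsSimpleSum.blockTensor h using 2 with k
    rw [← blockDiagonal'_diagonal (fun i s => w i k s), ← blockDiagonal'_mul, ← blockDiagonal'_mul,
      ← blockDiagonal'_sub]
    rfl

end DiagonalUpTo

/-! ### Rank one perturbations of cyclic matrices -/

section Cyclic

open Polynomial

variable {𝕜 : Type*} [Field 𝕜] {n : Type*} [Fintype n] [DecidableEq n]

/-- The vector `v` is cyclic for the matrix `N`: every vector is the image of `v` under a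
polynomial in `N`. -/
def IsCyclicVector (N : Matrix n n 𝕜) (v : n → 𝕜) : Prop :=
  ∀ u, ∃ p : 𝕜[X], aeval N p *ᵥ v = u

/-- Pole placement: a cyclic matrix `N` becomes diagonalizable after adding a suitable rank one
matrix whose column is a cyclic vector `v`. For distinct `t i` outside of the spectrum of `N`,
the vectors `x i = (t i - N)⁻¹ v` form a basis (by Lagrange interpolation at the points `t i`).
The perturbation `N + v ρ` has the eigenvectors `x i` with eigenvalues `t i` if `ρ` takes the
value `1` at each `x i`. -/
theorem IsCyclicVector.exists_diagonalization [Infinite 𝕜] {N : Matrix n n 𝕜} {v : n → 𝕜}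
    (hv : IsCyclicVector N v) :
    ∃ (ρ t : n → 𝕜) (X : Matrix n n 𝕜), IsUnit X ∧
      N + vecMulVec v ρ = X * diagonal t * X⁻¹ := by
  have hfin : {x | N.charpoly.IsRoot x}.Finite :=
    Polynomial.finite_setOfPred_isRoot N.charpoly_monic.ne_zero
  have := hfin.infinite_compl.to_subtype
  let t' : n ↪ ({x | N.charpoly.IsRoot x}ᶜ : Set 𝕜) :=
    (Fintype.equivFin n).toEmbedding.trans (Fin.valEmbedding.trans (Infinite.natEmbedding _))
  let t : n → 𝕜 := fun i => t' i
  have ht : Function.Injective t := Subtype.val_injective.comp t'.injective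
  have hdet : ∀ i, IsUnit (scalar n (t i) - N).det := fun i => by
    rw [← eval_charpoly, isUnit_iff_ne_zero]
    exact (t' i).2
  let x : n → n → 𝕜 := fun i => (scalar n (t i) - N)⁻¹ *ᵥ v
  have hx : ∀ i, (scalar n (t i) - N) *ᵥ x i = v := fun i => by
    rw [mulVec_mulVec, mul_nonsing_inv _ (hdet i), one_mulVec]
  have haev : ∀ i, aeval N (X - C (t i)) = -(scalar n (t i) - N) := fun i => by
    simp [algebraMap_eq_diagonal, Pi.algebraMap_def]
  have hx' : ∀ i, aeval N (X - C (t i)) *ᵥ x i = -v := fun i => by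
    rw [haev, neg_mulVec, hx]
  let Q := aeval N (Lagrange.nodal Finset.univ t)
  have hQ : IsUnit Q := by
    have : ∀ s : Finset n, IsUnit (aeval N (Lagrange.nodal s t)) := by
      intro s
      induction s using Finset.induction_on with
      | empty => simp
      | insert i s hi ih =>
        rw [Lagrange.nodal_insert_eq_nodal hi, map_mul, haev]
        exact ((isUnit_iff_isUnit_det _).2 (hdet i)).neg.mul ih
    exact this _
  have hbasis : ∀ i, ∃ c : 𝕜, aeval N (Lagrange.basis Finset.univ t i) *ᵥ v = Q *ᵥ (c • x i) := by
    intro i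
    refine ⟨-Lagrange.nodalWeight Finset.univ t i, ?_⟩
    have h1 : Lagrange.basis Finset.univ t i = C (Lagrange.nodalWeight Finset.univ t i) *
        Lagrange.nodal (Finset.univ.erase i) t := by
      simp only [Lagrange.basis, Lagrange.basisDivisor, Lagrange.nodalWeight, Lagrange.nodal,
        Finset.prod_mul_distrib, map_prod]
    have h2 : Q = aeval N (Lagrange.nodal (Finset.univ.erase i) t) * aeval N (X - C (t i)) := by
      rw [← map_mul, mul_comm, ← Lagrange.nodal_eq_mul_nodal_erase (Finset.mem_univ i)]
    rw [mulVec_smul, h2, ← mulVec_mulVec, hx', h1, map_mul, aeval_C, ← Algebra.smul_def,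
      smul_mulVec, mulVec_neg, smul_neg, neg_smul, neg_neg]
  choose c hc using hbasis
  let Y : Matrix n n 𝕜 := (of x)ᵀ
  have hY : IsUnit Y := by
    rw [← mulVec_surjective_iff_isUnit]
    intro u
    obtain ⟨p, hp⟩ := hv (Q *ᵥ u)
    -- reduce the degree by the Cayley-Hamilton theorem
    have h1 : aeval N (p %ₘ N.charpoly) = aeval N p :=
      aeval_modByMonic_eq_self_of_root (aeval_self_charpoly N)
    have h2 : (p %ₘ N.charpoly).degree < (Finset.univ : Finset n).card := by
      rw [Finset.card_univ, ← charpoly_degree_eq_dim N]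
      exact degree_modByMonic_lt p N.charpoly_monic
    rw [← h1, Lagrange.eq_interpolate ht.injOn h2, Lagrange.interpolate_apply, map_sum,
      sum_mulVec] at hp
    refine ⟨fun i => (p %ₘ N.charpoly).eval (t i) * c i, mulVec_injective_of_isUnit hQ ?_⟩
    have h3 : (Y *ᵥ fun i => (p %ₘ N.charpoly).eval (t i) * c i) =
        ∑ i, ((p %ₘ N.charpoly).eval (t i) * c i) • x i := by
      simp only [mulVec_eq_sum, op_smul_eq_smul]
      rfl
    rw [h3, ← hp, mulVec_sum]
    refine Finset.sum_congr rfl fun i _ => ?_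
    rw [map_mul, aeval_C, ← Algebra.smul_def, smul_mulVec, hc, mul_smul, mulVec_smul Q]
  refine ⟨1 ᵥ* Y⁻¹, t, Y, hY, ?_⟩
  have hY' := (isUnit_iff_isUnit_det _).1 hY
  rw [← mul_nonsing_inv_cancel_right Y (N + _) hY']
  congr 1
  rw [Matrix.add_mul, vecMulVec_mul, vecMul_vecMul, nonsing_inv_mul _ hY', vecMul_one]
  ext a i
  have h1 : (t i • x i - N *ᵥ x i) a = v a := by
    rw [← hx i, sub_mulVec, scalar_apply, ← smul_one_eq_diagonal, smul_mulVec, one_mulVec]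
  have h2 : (N * Y) a i = (N *ᵥ x i) a := rfl
  rw [mul_diagonal, Matrix.add_apply, h2, vecMulVec_apply, ← h1]
  simp [Y, mul_comm]

end Cyclic

/-! ### Cyclic pencils -/

section CyclicPencils

open Polynomial

variable {𝕜 : Type*} [Field 𝕜]

/-- The pencil `T 0 - X * T 1` is nonsingular at `t`, and the matrix `(T 0 - t * T 1)⁻¹ * T 1`
has a cyclic vector and is annihilated by the polynomial `f`. Rows and columns may have different
index types, so the inverse is given as a two-sided inverse. -/
def IsCyclicPencil {ι κ : Type*} [Fintype ι] [Fintype κ] [DecidableEq ι] [DecidableEq κ]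
    (T : Fin 2 → Matrix ι κ 𝕜) (t : 𝕜) (f : 𝕜[X]) : Prop :=
  ∃ R : Matrix κ ι 𝕜, (T 0 - t • T 1) * R = 1 ∧ R * (T 0 - t • T 1) = 1 ∧
    (∃ v, IsCyclicVector (R * T 1) v) ∧ aeval (R * T 1) f = 0

theorem isSimpleSum_smul_vecMulVec {ι κ : Type*} (c : Fin 2 → 𝕜) (u : ι → 𝕜) (ρ : κ → 𝕜) :
    IsSimpleSum (fun k => c k • vecMulVec u ρ) 1 := by
  refine ⟨of fun i _ => u i, fun k _ => c k, of fun _ j => ρ j, fun k => ?_⟩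
  ext i j
  rw [mul_apply]
  simp only [mul_diagonal, Matrix.smul_apply, vecMulVec_apply, of_apply, Fin.sum_univ_one,
    smul_eq_mul]
  ring

/-- A cyclic pencil is diagonal up to one simple tensor: with `S = T 0 - t * T 1` and
`N = S⁻¹ * T 1`, the slices are `S + t * S * N` and `S * N`, and a rank one perturbation makes `N`
diagonalizable. -/
theorem IsCyclicPencil.isDiagonalUpTo [Infinite 𝕜] {ι κ : Type*} [Fintype ι] [Fintype κ]
    [DecidableEq ι] [DecidableEq κ] {T : Fin 2 → Matrix ι κ 𝕜} {t : 𝕜} {f : 𝕜[X]}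
    (h : IsCyclicPencil T t f) : IsDiagonalUpTo T (Fintype.card κ) 1 := by
  obtain ⟨R, hR, hR', ⟨v, hv⟩, -⟩ := h
  obtain ⟨ρ, d, Y, hY, hd⟩ := hv.exists_diagonalization
  have hY' := (isUnit_iff_isUnit_det _).1 hY
  set S := T 0 - t • T 1 with hS
  have h1 : T 1 = S * (R * T 1) := by rw [← Matrix.mul_assoc, hR, Matrix.one_mul]
  have h0 : T 0 = S + t • T 1 := by rw [hS, sub_add_cancel]
  have hYd : S * Y * diagonal d * Y⁻¹ = T 1 + S * vecMulVec v ρ := by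
    rw [Matrix.mul_assoc S, Matrix.mul_assoc S, ← hd, Matrix.mul_add, ← h1]
  have hY1 : S * Y * Y⁻¹ = S := mul_nonsing_inv_cancel_right _ _ hY'
  refine .of_fintype rfl (S * Y) ![fun i => 1 + t * d i, d] Y⁻¹ (Y⁻¹ * R) Y ?_
    (nonsing_inv_mul _ hY') ?_
  · rw [Matrix.mul_assoc, ← Matrix.mul_assoc R, hR', Matrix.one_mul, nonsing_inv_mul _ hY']
  · have hdiag : diagonal (fun i => 1 + t * d i) = 1 + t • diagonal d := by
      rw [← diagonal_one, ← diagonal_smul, diagonal_add]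
      rfl
    convert isSimpleSum_smul_vecMulVec ![-t, -1] (S *ᵥ v) ρ using 2 with k
    rw [← mul_vecMulVec]
    fin_cases k
    · change T 0 - S * Y * diagonal (fun i => 1 + t * d i) * Y⁻¹ = -t • (S * vecMulVec v ρ)
      rw [hdiag, Matrix.mul_add, Matrix.add_mul, Matrix.mul_one, hY1, Matrix.mul_smul,
        Matrix.smul_mul, hYd, h0]
      module
    · change T 1 - S * Y * diagonal d * Y⁻¹ = (-1 : 𝕜) • (S * vecMulVec v ρ)
      rw [hYd]
      module

theorem blockDiagonal'_mulVec_apply {I : Type*} [Fintype I] [DecidableEq I] {R C : I → Type*}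
    [∀ i, Fintype (C i)] (M : ∀ i, Matrix (R i) (C i) 𝕜) (x : ((i : I) × C i) → 𝕜) (i : I)
    (a : R i) : (blockDiagonal' M *ᵥ x) ⟨i, a⟩ = (M i *ᵥ fun c => x ⟨i, c⟩) a := by
  simp only [mulVec, dotProduct, Fintype.sum_sigma]
  rw [Finset.sum_eq_single i]
  · simp only [blockDiagonal'_apply_eq]
  · intro j _ hj
    simp only [blockDiagonal'_apply_ne _ _ _ hj.symm, zero_mul, Finset.sum_const_zero]
  · simp

theorem aeval_blockDiagonal' {I : Type*} [Fintype I] [DecidableEq I] {C : I → Type*}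
    [∀ i, Fintype (C i)] [∀ i, DecidableEq (C i)] (N : ∀ i, Matrix (C i) (C i) 𝕜) (p : 𝕜[X]) :
    aeval (blockDiagonal' N) p = blockDiagonal' fun i => aeval (N i) p := by
  induction p using Polynomial.induction_on' with
  | add p q hp hq =>
    rw [map_add, hp, hq, ← blockDiagonal'_add]
    congr 1
    ext1 i
    exact (map_add _ _ _).symm
  | monomial k c =>
    simp only [aeval_monomial, ← Algebra.smul_def]
    rw [← blockDiagonal'_pow, ← blockDiagonal'_smul]
    rfl

/-- By the Chinese remainder theorem, cyclic pencils with coprime annihilators have a cyclic block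
diagonal sum. -/
theorem IsCyclicPencil.blockTensor {I : Type*} [Fintype I] [DecidableEq I] {R C : I → Type*}
    [∀ i, Fintype (R i)] [∀ i, Fintype (C i)] [∀ i, DecidableEq (R i)] [∀ i, DecidableEq (C i)]
    {T : ∀ i, Fin 2 → Matrix (R i) (C i) 𝕜} {t : 𝕜} {f : I → 𝕜[X]}
    (h : ∀ i, IsCyclicPencil (T i) t (f i)) (hf : Pairwise fun i j => IsCoprime (f i) (f j)) :
    IsCyclicPencil (_root_.blockTensor T) t (∏ i, f i) := by
  choose S hS hS' hv hN using fun i => show ∃ _, _ from h i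
  choose v hv using hv
  have hsub : _root_.blockTensor T 0 - t • _root_.blockTensor T 1 =
      blockDiagonal' fun i => T i 0 - t • T i 1 := by
    rw [_root_.blockTensor, _root_.blockTensor, ← blockDiagonal'_smul, ← blockDiagonal'_sub]
    rfl
  refine ⟨blockDiagonal' S, ?_, ?_, ⟨fun x => v x.1 x.2, fun u => ?_⟩, ?_⟩
  · rw [hsub, ← blockDiagonal'_mul, ← blockDiagonal'_one]
    exact congrArg _ (funext hS)
  · rw [hsub, ← blockDiagonal'_mul, ← blockDiagonal'_one]
    exact congrArg _ (funext hS')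
  · choose p hp using fun i => hv i fun c => u ⟨i, c⟩
    obtain ⟨q, hq⟩ := Ideal.exists_forall_sub_mem_ideal
      (I := fun i => Ideal.span {f i})
      (fun i j hij => (Ideal.isCoprime_span_singleton_iff _ _).2 (hf hij)) p
    refine ⟨q, ?_⟩
    rw [_root_.blockTensor, ← blockDiagonal'_mul, aeval_blockDiagonal']
    ext ⟨i, c⟩
    obtain ⟨g, hg⟩ := Ideal.mem_span_singleton.1 (hq i)
    rw [blockDiagonal'_mulVec_apply, sub_eq_iff_eq_add.1 hg, map_add, map_mul, hN, zero_mul,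
      zero_add, hp]
  · rw [_root_.blockTensor, ← blockDiagonal'_mul, aeval_blockDiagonal', ← blockDiagonal'_zero]
    congr 1
    ext1 i
    obtain ⟨g, hg⟩ := Finset.dvd_prod_of_mem f (Finset.mem_univ i)
    rw [hg, map_mul, hN, zero_mul]
    rfl

variable {n : Type*} [Fintype n] [DecidableEq n]

/-- A form of Nakayama's lemma: if `g(N)` is nilpotent, it suffices to reach every vector modulo
the range of `g(N)`. -/
theorem isCyclicVector_of_pow_eq_zero {N : Matrix n n 𝕜} {v : n → 𝕜} {g : 𝕜[X]} {k : ℕ}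
    (hg : aeval N g ^ k = 0)
    (h : ∀ u, ∃ (p : 𝕜[X]) (y : n → 𝕜), u = aeval N p *ᵥ v + aeval N g *ᵥ y) :
    IsCyclicVector N v := by
  have key : ∀ j u, ∃ (p : 𝕜[X]) (y : n → 𝕜), u = aeval N p *ᵥ v + aeval N g ^ j *ᵥ y := by
    intro j
    induction j with
    | zero => exact fun u => ⟨0, u, by simp⟩
    | succ j ih =>
      intro u
      obtain ⟨p, y, rfl⟩ := ih u
      obtain ⟨q, z, rfl⟩ := h y
      refine ⟨p + g ^ j * q, z, ?_⟩
      rw [map_add, map_mul, map_pow, add_mulVec, mulVec_add, mulVec_mulVec, mulVec_mulVec,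
        pow_succ, add_assoc]
  intro u
  obtain ⟨p, y, hp⟩ := key k u
  exact ⟨p, by rw [hp, hg, zero_mulVec, add_zero]⟩

/-- The criterion for a single block: if a polynomial `g(N)` in `N = S⁻¹ * T 1` is the product of a
nilpotent `J` and a unit `W` commuting with it, a vector is cyclic as soon as it reaches every
vector modulo the range of `J`. -/
theorem isCyclicPencil_of_nilpotent {T : Fin 2 → Matrix n n 𝕜} {t : 𝕜} {S W : (Matrix n n 𝕜)ˣ}
    {N J : Matrix n n 𝕜} {k : ℕ} (hS : T 0 - t • T 1 = S) (hN : (↑S⁻¹ : Matrix n n 𝕜) * T 1 = N)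
    (hJ : J ^ k = 0) (hJW : Commute J W) {g : 𝕜[X]} (hg : aeval N g = J * W) {v : n → 𝕜}
    (hv : ∀ u, ∃ (p : 𝕜[X]) (y : n → 𝕜), u = aeval N p *ᵥ v + J *ᵥ y) :
    IsCyclicPencil T t (g ^ k) := by
  have hgk : aeval N g ^ k = 0 := by rw [hg, hJW.mul_pow, hJ, zero_mul]
  rw [IsCyclicPencil, hS]
  refine ⟨↑S⁻¹, S.mul_inv, S.inv_mul, ⟨v, ?_⟩, ?_⟩ <;> rw [hN]
  · refine isCyclicVector_of_pow_eq_zero hgk fun u => ?_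
    obtain ⟨p, y, rfl⟩ := hv u
    refine ⟨p, (↑W⁻¹ : Matrix n n 𝕜) *ᵥ y, ?_⟩
    rw [hg, mulVec_mulVec, Units.mul_inv_cancel_right]
  · rw [map_pow, hgk]

end CyclicPencils

/-! ### Blocks of type B, C and D as cyclic pencils -/

section CyclicBlocks

open Polynomial
open scoped Kronecker

variable {𝕜 : Type*} [Field 𝕜]

theorem nilJordan_mulVec_apply {k : ℕ} (y : Fin k → 𝕜) (a : Fin k) :
    (nilJordan 𝕜 k *ᵥ y) a = if h : (a : ℕ) + 1 < k then y ⟨a + 1, h⟩ else 0 := by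
  simp only [mulVec, dotProduct, nilJordan, of_apply, ite_mul, one_mul, zero_mul]
  split_ifs with h
  · rw [Finset.sum_eq_single ⟨a + 1, h⟩]
    · simp
    · intro b _ hb
      rw [if_neg fun e => hb (Fin.ext e.symm)]
    · simp
  · refine Finset.sum_eq_zero fun b _ => if_neg fun e => h ?_
    rw [e]
    exact b.2

theorem nilJordan_pow_self (k : ℕ) : nilJordan 𝕜 k ^ k = 0 := by
  have key : ∀ (j : ℕ) (y : Fin k → 𝕜) (a : Fin k), k ≤ a + j → (nilJordan 𝕜 k ^ j *ᵥ y) a = 0 := by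
    intro j
    induction j with
    | zero => exact fun y a h => absurd a.2 (by omega)
    | succ j ih =>
      intro y a h
      rw [pow_succ', ← mulVec_mulVec, nilJordan_mulVec_apply]
      split_ifs
      · exact ih _ _ (by simp only; omega)
      · rfl
  ext a b
  simpa using key k (Pi.single b 1) a (by omega)

/-- The range of `J_k` consists of the vectors with last entry `0`. -/
theorem exists_eq_nilJordan_mulVec {k : ℕ} {u : Fin k → 𝕜}
    (hu : ∀ a : Fin k, (a : ℕ) + 1 = k → u a = 0) :
    ∃ y, u = nilJordan 𝕜 k *ᵥ y := by
  refine ⟨fun b => u ⟨b - 1, by omega⟩, ?_⟩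
  ext a
  rw [nilJordan_mulVec_apply]
  split_ifs with h
  · rfl
  · exact hu a (by omega)

/-- Every vector is a multiple of the last basis vector modulo the range of `J_k`. -/
theorem exists_eq_smul_single_add_nilJordan_mulVec {k : ℕ} {a : Fin k} (ha : (a : ℕ) + 1 = k)
    (u : Fin k → 𝕜) :
    ∃ (c : 𝕜) (y : Fin k → 𝕜), u = c • Pi.single a 1 + nilJordan 𝕜 k *ᵥ y := by
  obtain ⟨y, hy⟩ := exists_eq_nilJordan_mulVec (u := u - u a • Pi.single a 1) fun b hb => by
    obtain rfl : b = a := Fin.ext (by omega)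
    simp
  exact ⟨_, y, by rw [← hy]; abel⟩

theorem aeval_C_mulVec {n : Type*} [Fintype n] [DecidableEq n] (N : Matrix n n 𝕜) (c : 𝕜)
    (v : n → 𝕜) : aeval N (C c) *ᵥ v = c • v := by
  rw [aeval_C, Algebra.algebraMap_eq_smul_one, smul_mulVec, one_mulVec]

theorem isCyclicVector_nilJordan {k : ℕ} {a : Fin k} (ha : (a : ℕ) + 1 = k) :
    IsCyclicVector (nilJordan 𝕜 k) (Pi.single a 1) := by
  refine isCyclicVector_of_pow_eq_zero (g := X) (k := k) ?_ fun u => ?_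
  · rw [aeval_X, nilJordan_pow_self]
  · obtain ⟨c, y, h⟩ := exists_eq_smul_single_add_nilJordan_mulVec ha u
    exact ⟨C c, y, by rw [aeval_C_mulVec, aeval_X, h]⟩

/-- With `S = (x - t) E_k + J_k` and `N = S⁻¹`, one has `1 - (x - t) N = J_k * S⁻¹`. -/
theorem isCyclicPencil_typeB {x t : 𝕜} (hx : x ≠ t) {k : ℕ} (hk : 1 ≤ k) :
    IsCyclicPencil ![x • 1 + nilJordan 𝕜 k, 1] t ((1 - C (x - t) * X) ^ k) := by
  have hunit : IsUnit ((x - t) • 1 + nilJordan 𝕜 k) :=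
    IsNilpotent.isUnit_add_left_of_commute ⟨k, nilJordan_pow_self k⟩
      (isUnit_one.smul (Units.mk0 _ (sub_ne_zero.2 hx)))
      ((Commute.one_right _).smul_right _)
  obtain ⟨S, hS⟩ := hunit
  obtain ⟨a, ha⟩ : ∃ a : Fin k, (a : ℕ) + 1 = k := ⟨⟨k - 1, by omega⟩, by simp only; omega⟩
  have hcomm : Commute (nilJordan 𝕜 k) S := by
    rw [hS]
    exact ((Commute.one_right _).smul_right _).add_right (Commute.refl _)
  refine isCyclicPencil_of_nilpotent (S := S) (W := S⁻¹) (N := ↑S⁻¹)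
    (v := Pi.single a 1) ?_ ?_ (nilJordan_pow_self k) hcomm.units_inv_right ?_
    fun u => ?_
  · rw [hS]
    simp only [cons_val_zero, cons_val_one]
    module
  · simp
  · rw [← sub_eq_iff_eq_add'.2 hS, sub_mul, S.mul_inv]
    simp [Algebra.algebraMap_eq_smul_one, ← sub_smul]
  · obtain ⟨c, y, h⟩ := exists_eq_smul_single_add_nilJordan_mulVec ha u
    exact ⟨C c, y, by rw [aeval_C_mulVec, h]⟩

/-- With `S = E_k - t J_k`, one has `N = S⁻¹ * J_k = J_k * S⁻¹`. -/
theorem isCyclicPencil_typeD (t : 𝕜) {k : ℕ} (hk : 1 ≤ k) :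
    IsCyclicPencil ![1, nilJordan 𝕜 k] t (X ^ k) := by
  have hunit : IsUnit (1 - t • nilJordan 𝕜 k) :=
    IsNilpotent.isUnit_one_sub ⟨k, by rw [_root_.smul_pow, nilJordan_pow_self, smul_zero]⟩
  obtain ⟨S, hS⟩ := hunit
  obtain ⟨a, ha⟩ : ∃ a : Fin k, (a : ℕ) + 1 = k := ⟨⟨k - 1, by omega⟩, by simp only; omega⟩
  have hcomm : Commute (nilJordan 𝕜 k) S := by
    rw [hS]
    exact (Commute.one_right _).sub_right ((Commute.refl _).smul_right _)
  refine isCyclicPencil_of_nilpotent (S := S) (W := S⁻¹)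
    (N := (↑S⁻¹ : Matrix (Fin k) (Fin k) 𝕜) * nilJordan 𝕜 k)
    (v := Pi.single a 1) hS.symm rfl (nilJordan_pow_self k)
    hcomm.units_inv_right ?_ fun u => ?_
  · rw [aeval_X, hcomm.units_inv_right.eq]
  · obtain ⟨c, y, h⟩ := exists_eq_smul_single_add_nilJordan_mulVec ha u
    exact ⟨C c, y, by rw [aeval_C_mulVec, h]⟩

theorem nilJordan_kronecker_one_mulVec_apply {k : ℕ} (y : Fin k × Fin 2 → 𝕜) (a : Fin k)
    (ε : Fin 2) : ((nilJordan 𝕜 k ⊗ₖ (1 : Matrix (Fin 2) (Fin 2) 𝕜)) *ᵥ y) (a, ε) =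
      (nilJordan 𝕜 k *ᵥ fun b => y (b, ε)) a := by
  simp [mulVec, dotProduct, Fintype.sum_prod_type, one_apply]

theorem exists_eq_nilJordan_kronecker_one_mulVec {k : ℕ} {u : Fin k × Fin 2 → 𝕜}
    (hu : ∀ a : Fin k, (a : ℕ) + 1 = k → ∀ ε, u (a, ε) = 0) :
    ∃ y, u = (nilJordan 𝕜 k ⊗ₖ (1 : Matrix (Fin 2) (Fin 2) 𝕜)) *ᵥ y := by
  choose y hy using fun ε =>
    exists_eq_nilJordan_mulVec (u := fun a => u (a, ε)) fun a ha => hu a ha ε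
  refine ⟨fun x => y x.2 x.1, ?_⟩
  ext ⟨a, ε⟩
  rw [nilJordan_kronecker_one_mulVec_apply]
  exact congrFun (hy ε) a

theorem kronecker_one_pow {l m : Type*} [Fintype l] [DecidableEq l] [Fintype m] [DecidableEq m]
    (M : Matrix l l 𝕜) (j : ℕ) :
    (M ⊗ₖ (1 : Matrix m m 𝕜)) ^ j = (M ^ j) ⊗ₖ (1 : Matrix m m 𝕜) := by
  induction j with
  | zero => simp
  | succ j ih => rw [pow_succ, ih, ← mul_kronecker_mul, ← pow_succ, Matrix.mul_one]

theorem IsCyclicPencil.submatrix {ι κ ι' κ' : Type*} [Fintype ι] [Fintype κ] [DecidableEq ι]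
    [DecidableEq κ] [Fintype ι'] [Fintype κ'] [DecidableEq ι'] [DecidableEq κ']
    {T : Fin 2 → Matrix ι κ 𝕜} {t : 𝕜} {f : 𝕜[X]} (h : IsCyclicPencil T t f) (e : ι' ≃ ι)
    (e' : κ' ≃ κ) : IsCyclicPencil (fun k => (T k).submatrix e e') t f := by
  obtain ⟨R, hR, hR', ⟨v, hv⟩, hN⟩ := h
  have haev : ∀ p : 𝕜[X], aeval ((R * T 1).submatrix e' e') p =
      (aeval (R * T 1) p).submatrix e' e' := fun p =>
    aeval_algHom_apply (reindexAlgEquiv 𝕜 𝕜 e'.symm).toAlgHom (R * T 1) p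
  have h1 : R.submatrix e' e * (T 1).submatrix e e' = (R * T 1).submatrix e' e' :=
    submatrix_mul_equiv _ _ _ _ _
  have h2 : (T 0).submatrix e e' - t • (T 1).submatrix e e' =
    (T 0 - t • T 1).submatrix e e' := rfl
  refine ⟨R.submatrix e' e, ?_, ?_, ⟨v ∘ e', fun u => ?_⟩, ?_⟩
  · rw [h2, submatrix_mul_equiv, hR, submatrix_one_equiv]
  · rw [h2, submatrix_mul_equiv, hR', submatrix_one_equiv]
  · obtain ⟨p, hp⟩ := hv (u ∘ e'.symm)
    refine ⟨p, ?_⟩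
    rw [h1, haev, submatrix_mulVec_equiv, Function.comp_assoc, e'.self_comp_symm,
      Function.comp_id, hp, Function.comp_assoc, e'.symm_comp_self, Function.comp_id]
  · rw [h1, haev, hN]
    rfl

/-- With `a = c - t`, the matrix `S = T 0 - t * T 1` is `a + D + K`, where `K = J_k ⊗ E_2` is
nilpotent and `D = E_k ⊗ (0, -s; s, 0)` has the square `-s ^ 2`. So `(S - a) ^ 2 + s ^ 2 = K * W₀`
with `W₀ = 2 * D + K` invertible, and multiplication by `N ^ 2`, where `N = S⁻¹`, gives
`1 - 2 * a * N + (a ^ 2 + s ^ 2) * N ^ 2 = K * W₀ * N ^ 2`. -/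
theorem isCyclicPencil_typeC {c s t : 𝕜} (h2 : (2 : 𝕜) ≠ 0) (hs : ∀ y : 𝕜, y * y + s * s ≠ 0)
    {k : ℕ} (hk : 1 ≤ k) :
    IsCyclicPencil ![rotJordan c s k, 1] t
      ((1 - C (2 * (c - t)) * X + C ((c - t) * (c - t) + s * s) * X ^ 2) ^ k) := by
  set K : Matrix (Fin k × Fin 2) (Fin k × Fin 2) 𝕜 :=
    nilJordan 𝕜 k ⊗ₖ (1 : Matrix (Fin 2) (Fin 2) 𝕜) with hK
  obtain ⟨a, ha⟩ : ∃ a, a = c - t := ⟨_, rfl⟩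
  rw [← ha]
  let D : Matrix (Fin k × Fin 2) (Fin k × Fin 2) 𝕜 :=
    (1 : Matrix (Fin k) (Fin k) 𝕜) ⊗ₖ !![0, -s; s, 0]
  have hs0 : s ≠ 0 := fun e => hs 0 (by simp [e])
  have hKk : K ^ k = 0 := by rw [hK, kronecker_one_pow, nilJordan_pow_self, zero_kronecker]
  have hKD : Commute K D := by
    rw [Commute, SemiconjBy, hK, ← mul_kronecker_mul, ← mul_kronecker_mul]
    simp
  have hDD : D * D = -(s * s) • 1 := by
    rw [← mul_kronecker_mul, Matrix.one_mul, ← one_kronecker_one, ← kronecker_smul]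
    congr 1
    ext i j
    fin_cases i <;> fin_cases j <;> simp
  have hunit : ∀ x y : 𝕜, y ≠ 0 → IsUnit (x • 1 + y • D) := by
    intro x y hy
    have hne : x * x + y * y * (s * s) ≠ 0 := fun e => hs (x / y) (by
      field_simp
      linear_combination e)
    refine IsUnit.of_mul_eq_one ((x * x + y * y * (s * s))⁻¹ • (x • 1 - y • D)) ?_
    rw [mul_smul_comm, add_mul, mul_sub, mul_sub, smul_mul_smul_comm, smul_mul_smul_comm,
      smul_mul_smul_comm, smul_mul_smul_comm, hDD, one_mul, one_mul, mul_one, inv_smul_eq_iff₀ hne]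
    module
  have hcomm1 : ∀ x y : 𝕜, Commute K (x • 1 + y • D) := fun x y =>
    ((Commute.one_right _).smul_right _).add_right (hKD.smul_right _)
  obtain ⟨S, hS⟩ := IsNilpotent.isUnit_add_left_of_commute ⟨k, hKk⟩ (hunit a 1 one_ne_zero)
    (hcomm1 a 1)
  obtain ⟨W₀, hW₀⟩ := IsNilpotent.isUnit_add_left_of_commute ⟨k, hKk⟩ (hunit 0 2 h2) (hcomm1 0 2)
  have hKS : Commute K S := by
    rw [hS]
    exact (hcomm1 a 1).add_right (Commute.refl _)
  have hKW : Commute K W₀ := by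
    rw [hW₀]
    exact (hcomm1 0 2).add_right (Commute.refl _)
  have hrot : (![rotJordan c s k, 1] : Fin 2 → Matrix (Fin (k * 2)) (Fin (k * 2)) 𝕜) =
      fun j => ((![(S : Matrix (Fin k × Fin 2) (Fin k × Fin 2) 𝕜) + t • 1, 1] : Fin 2 →
        Matrix (Fin k × Fin 2) (Fin k × Fin 2) 𝕜) j).submatrix
        finProdFinEquiv.symm finProdFinEquiv.symm := by
    funext j
    fin_cases j
    · change (_ + K).submatrix _ _ =
        ((S : Matrix (Fin k × Fin 2) (Fin k × Fin 2) 𝕜) + t • 1).submatrix _ _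
      congr 1
      rw [hS]
      have : (1 : Matrix (Fin k) (Fin k) 𝕜) ⊗ₖ !![c, -s; s, c] = c • 1 + D := by
        rw [← one_kronecker_one, ← kronecker_smul, ← kronecker_add]
        congr 1
        ext i j
        fin_cases i <;> fin_cases j <;> simp
      rw [this, ha]
      module
    · simp
  rw [hrot]
  refine IsCyclicPencil.submatrix ?_ _ _
  obtain ⟨i, hi⟩ : ∃ i : Fin k, (i : ℕ) + 1 = k := ⟨⟨k - 1, by omega⟩, by simp only; omega⟩
  -- `S * v₀` is cyclic, since `N` maps it to `v₀`, and `v₀`, `S * v₀` span the space modulo the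
  -- range of `K`
  set v₀ : Fin k × Fin 2 → 𝕜 := Pi.single (i, 0) 1 with hv₀
  refine isCyclicPencil_of_nilpotent (S := S) (W := W₀ * (S⁻¹ * S⁻¹)) (N := ↑S⁻¹)
    (v := (S : Matrix (Fin k × Fin 2) (Fin k × Fin 2) 𝕜) *ᵥ v₀) (by simp) (by simp) hKk
    (hKW.mul_right (hKS.units_inv_right.mul_right hKS.units_inv_right)) ?_ fun u => ?_
  · set R : Matrix (Fin k × Fin 2) (Fin k × Fin 2) 𝕜 := ↑S⁻¹ with hR
    have hE : (S : Matrix (Fin k × Fin 2) (Fin k × Fin 2) 𝕜) - a • 1 = D + K := by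
      rw [hS]
      module
    have h1 : (D + K) * (D + K) = K * W₀ - (s * s) • 1 := by
      rw [hW₀, add_mul, mul_add, mul_add, hDD, ← hKD.eq, mul_add, mul_add, mul_smul_comm,
        mul_smul_comm]
      module
    have h3 : (D + K) * R = 1 - a • R := by
      rw [← hE, sub_mul, hR, S.mul_inv, smul_mul_assoc, one_mul]
    have h4 : (1 - a • R) * R = R * (1 - a • R) := by
      rw [sub_mul, mul_sub, one_mul, mul_one, smul_mul_assoc, mul_smul_comm]
    have h5 : K * W₀ * (R * R) = (1 - a • R) * (1 - a • R) + (s * s) • (R * R) := by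
      rw [sub_eq_iff_eq_add.1 h1.symm, add_mul, smul_mul_assoc, one_mul, mul_assoc (D + K),
        ← mul_assoc (D + K) R R, h3, h4, ← mul_assoc (D + K), h3]
    have h6 : (1 - a • R) * (1 - a • R) = 1 - (2 * a) • R + (a * a) • (R * R) := by
      simp only [sub_mul, mul_sub, smul_mul_assoc, mul_smul_comm, one_mul, mul_one]
      module
    rw [Units.val_mul, Units.val_mul, ← mul_assoc, ← hR, h5, h6]
    simp only [map_add, map_sub, map_mul, map_one, aeval_C, aeval_X,
      Algebra.algebraMap_eq_smul_one, add_mul, smul_mul_assoc, one_mul, pow_two]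
    module
  · set α := u (i, 1) / s
    set β := u (i, 0) - α * a
    obtain ⟨y, hy⟩ := exists_eq_nilJordan_kronecker_one_mulVec
      (u := u - (α • (a • v₀ + D *ᵥ v₀) + β • v₀)) fun b hb ε => by
        obtain rfl : b = i := Fin.ext (by omega)
        fin_cases ε
        · simp [hv₀, D, β]
        · simp [hv₀, D, α, hs0]
    refine ⟨C α + C β * X, y - α • v₀, ?_⟩
    rw [map_add, map_mul, aeval_X, add_mulVec, aeval_C_mulVec, ← mulVec_mulVec, aeval_C_mulVec,
      mulVec_mulVec, S.inv_mul, one_mulVec, hS, mulVec_sub, ← hy, mulVec_smul, add_mulVec,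
      add_mulVec, smul_mulVec, one_mulVec, one_smul]
    module

end CyclicBlocks

/-! ### Coprime annihilators -/

section Coprime

open Polynomial

variable {𝕜 : Type*} [Field 𝕜]

theorem isCoprime_linear_linear {x y : 𝕜} (hxy : x ≠ y) :
    IsCoprime (1 - C x * X) (1 - C y * X) := by
  have h := sub_ne_zero.2 hxy
  refine ⟨C (-y / (x - y)), C (x / (x - y)), ?_⟩
  have e1 : C (-y / (x - y)) + C (x / (x - y)) = (1 : 𝕜[X]) := by
    rw [← C_add, ← C_1]
    congr 1
    field_simp
    ring
  have e2 : C (-y / (x - y)) * C x + C (x / (x - y)) * C y = (0 : 𝕜[X]) := by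
    rw [← C_mul, ← C_mul, ← C_add, ← C_0]
    congr 1
    field_simp
    ring
  linear_combination e1 - X * e2

theorem isCoprime_X_of_eval_zero_ne {p : 𝕜[X]} (hp : p.eval 0 ≠ 0) : IsCoprime X p := by
  rw [← sub_zero (X : 𝕜[X]), ← C_0]
  refine ((irreducible_X_sub_C (0 : 𝕜)).coprime_iff_not_dvd).2 fun h => hp ?_
  exact dvd_iff_isRoot.1 h

theorem isCoprime_of_eval_ne_zero {p : 𝕜[X]} (hp : ∀ x, p.eval x ≠ 0) {u v : 𝕜}
    (huv : u ≠ 0 ∨ v ≠ 0) : IsCoprime p (C u * X + C v) := by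
  by_cases hu : u = 0
  · have hv : v ≠ 0 := by simpa [hu] using huv
    rw [hu, C_0, zero_mul, zero_add]
    exact isCoprime_comm.1 ((isCoprime_one_left).of_isCoprime_of_dvd_left
      ((isUnit_C.2 hv.isUnit).dvd))
  · have h1 : C u * X + C v = C u * (X - C (-v / u)) := by
      rw [mul_sub, ← C_mul, mul_div_cancel₀ _ hu, C_neg, sub_neg_eq_add]
    rw [h1, isCoprime_mul_unit_left_right (isUnit_C.2 (isUnit_iff_ne_zero.2 hu))]
    exact (((irreducible_X_sub_C _).coprime_iff_not_dvd).2 fun h => hp _ (dvd_iff_isRoot.1 h)).symm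

/-- The polynomial `(1 - a X) ^ 2 + (s X) ^ 2`. A power of it with `a = c - t` annihilates the
matrix `(T 0 - t * T 1)⁻¹ * T 1` of a block `T` of type C with parameters `c`, `s`. -/
noncomputable def rotPoly (a s : 𝕜) : 𝕜[X] := 1 - C (2 * a) * X + C (a * a + s * s) * X ^ 2

theorem eval_rotPoly_ne_zero {s : 𝕜} (hs : ∀ y : 𝕜, y * y + s * s ≠ 0) (a x : 𝕜) :
    (rotPoly a s).eval x ≠ 0 := by
  have h : (rotPoly a s).eval x = (1 - a * x) * (1 - a * x) + (s * x) * (s * x) := by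
    simp [rotPoly]
    ring
  rw [h]
  by_cases hx : x = 0
  · simp [hx]
  · intro e
    refine hs ((1 - a * x) / x) ?_
    field_simp
    linear_combination e

/-- The difference of the two polynomials is `X` times a nonzero polynomial of degree at most one,
and `rotPoly a s` has no roots. -/
theorem isCoprime_rotPoly_rotPoly (h2 : (2 : 𝕜) ≠ 0) {a a' s s' : 𝕜}
    (hs : ∀ y : 𝕜, y * y + s * s ≠ 0) (h : a ≠ a' ∨ s * s ≠ s' * s') :
    IsCoprime (rotPoly a s) (rotPoly a' s') := by
  have h1 : rotPoly a' s' = -(X * (C (a * a + s * s - (a' * a' + s' * s')) * X +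
      C (-(2 * (a - a'))))) + rotPoly a s * 1 := by
    simp only [rotPoly, map_add, map_sub, map_mul, map_neg]
    ring
  rw [h1]
  refine IsCoprime.add_mul_left_right (IsCoprime.neg_right (IsCoprime.mul_right ?_ ?_)) _
  · exact (isCoprime_X_of_eval_zero_ne (eval_rotPoly_ne_zero hs a 0)).symm
  · refine isCoprime_of_eval_ne_zero (eval_rotPoly_ne_zero hs a) ?_
    by_contra! hc
    have h3 : a = a' := by
      have := (mul_eq_zero.1 (neg_eq_zero.1 hc.2)).resolve_left h2
      exact sub_eq_zero.1 this
    subst h3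
    rcases h with h | h
    · exact h rfl
    · exact h (by linear_combination hc.1)

theorem isCoprime_rotPoly_linear {s : 𝕜} (hs : ∀ y : 𝕜, y * y + s * s ≠ 0) (a x : 𝕜) :
    IsCoprime (rotPoly a s) (1 - C x * X) := by
  have : 1 - C x * X = C (-x) * X + C 1 := by
    rw [C_neg, C_1]
    ring
  rw [this]
  exact isCoprime_of_eval_ne_zero (eval_rotPoly_ne_zero hs a) (Or.inr one_ne_zero)

end Coprime

/-! ### The upper bound for single blocks -/

section KroneckerUpperBound

open Polynomial

variable {𝕜 : Type*} [RCLike 𝕜]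

namespace KroneckerBlock

/-- The regular blocks that are not diagonal. -/
def IsDefective : KroneckerBlock 𝕜 → Prop
  | typeB _ k => 2 ≤ k
  | typeC _ _ _ => True
  | typeD k => 2 ≤ k
  | _ => False

/-- The eigenvalue of a regular block: a finite one for type B, a conjugate pair for type C, where
`s` matters up to sign, and the infinite one for type D. Irrelevant for the other blocks. -/
def eigenvalue : KroneckerBlock 𝕜 → 𝕜 ⊕ (𝕜 × 𝕜) ⊕ Unit
  | typeB x _ => .inl x
  | typeC c s _ => .inr (.inl (c, s * s))
  | _ => .inr (.inr ())

/-- For a regular block `(A; B)`, a polynomial annihilating `(A - t B)⁻¹ B`. It is `1` for the other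
blocks, where it is irrelevant. -/
noncomputable def annihilator (t : 𝕜) : KroneckerBlock 𝕜 → 𝕜[X]
  | typeB x k => (1 - C (x - t) * X) ^ k
  | typeC c s k => rotPoly (c - t) s ^ k
  | typeD k => X ^ k
  | _ => 1

theorem mul_self_add_mul_self_ne_zero {c s : 𝕜} {k : ℕ} (hb : (typeC c s k).Admissible) (y : 𝕜) :
    y * y + s * s ≠ 0 :=
  fun h => hb.2.1 (RCLike.eq_zero_of_mul_self_add_mul_self hb.1 h)

theorem isCyclicPencil {b : KroneckerBlock 𝕜} (hb : b.Admissible) (hd : b.IsDefective) {t : 𝕜}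
    (ht : ∀ x k, b = typeB x k → x ≠ t) : IsCyclicPencil b.tensor t (b.annihilator t) := by
  cases b with
  | typeB x k => exact isCyclicPencil_typeB (ht x k rfl) hb
  | typeC c s k =>
    exact isCyclicPencil_typeC two_ne_zero (mul_self_add_mul_self_ne_zero hb) hb.2.2
  | typeD k => exact isCyclicPencil_typeD t hb
  | _ => exact hd.elim

theorem isCoprime_annihilator {b b' : KroneckerBlock 𝕜} (hb : b.Admissible) (hb' : b'.Admissible)
    (hd : b.IsDefective) (hd' : b'.IsDefective) (hne : b.eigenvalue ≠ b'.eigenvalue) (t : 𝕜) :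
    IsCoprime (b.annihilator t) (b'.annihilator t) := by
  have hX : ∀ p : 𝕜[X], p.eval 0 = 1 → IsCoprime X p := fun p hp =>
    isCoprime_X_of_eval_zero_ne (by rw [hp]; exact one_ne_zero)
  cases b with
  | typeB x k =>
    cases b' with
    | typeB y l =>
      refine (isCoprime_linear_linear fun e => hne ?_).pow
      rw [sub_left_inj.1 e]
      rfl
    | typeC c s l =>
      exact (isCoprime_rotPoly_linear (mul_self_add_mul_self_ne_zero hb') _ _).symm.pow
    | typeD l => exact (hX _ (by simp)).symm.pow
    | _ => exact hd'.elim
  | typeC c s k =>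
    have hs := mul_self_add_mul_self_ne_zero hb
    cases b' with
    | typeB y l => exact (isCoprime_rotPoly_linear hs _ _).pow
    | typeC c' s' l =>
      refine (isCoprime_rotPoly_rotPoly two_ne_zero hs ?_).pow
      by_contra! hc
      refine hne ?_
      simp only [eigenvalue, hc.2, sub_left_inj.1 hc.1]
    | typeD l => exact (hX _ (by simp [rotPoly])).symm.pow
    | _ => exact hd'.elim
  | typeD k =>
    cases b' with
    | typeB y l => exact (hX _ (by simp)).pow
    | typeC c s l => exact (hX _ (by simp [rotPoly])).pow
    | typeD l => exact absurd rfl hne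
    | _ => exact hd'.elim
  | _ => exact hd.elim

/-- The number of diagonal entries of a block after the perturbation. -/
def core : KroneckerBlock 𝕜 → ℕ
  | typeA _ _ => 0
  | typeB _ k => k
  | typeC _ _ k => k * 2
  | typeD k => k
  | typeE k => k
  | typeF k => k

/-- Indicator of the blocks of type E. -/
def indE : KroneckerBlock 𝕜 → ℕ
  | typeE _ => 1
  | _ => 0

/-- Indicator of the blocks of type F. -/
def indF : KroneckerBlock 𝕜 → ℕ
  | typeF _ => 1
  | _ => 0

end KroneckerBlock

theorem isDiagonalUpTo_zero {k l : ℕ} :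
    IsDiagonalUpTo (![0, 0] : Fin 2 → Matrix (Fin k) (Fin l) 𝕜) 0 0 := by
  refine ⟨0, 0, 0, 0, 0, Subsingleton.elim _ _, Subsingleton.elim _ _, 0, 0, 0, fun k => ?_⟩
  fin_cases k <;> simp

theorem isDiagonalUpTo_fin_one (T : Fin 2 → Matrix (Fin 1) (Fin 1) 𝕜) : IsDiagonalUpTo T 1 0 := by
  refine ⟨1, fun k _ => T k 0 0, 1, 1, 1, Matrix.one_mul _, Matrix.one_mul _, 0, 0, 0, fun k => ?_⟩
  ext i j
  fin_cases i
  fin_cases j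
  simp

/-- The slices of a block of type E are `(J_k, e_k)` and `(E_k, 0)`. A perturbation of the first one
of rank one cancels the column `e_k` and makes the matrix `J_k`, for which `e_k` is cyclic,
diagonalizable. -/
theorem isDiagonalUpTo_typeE {k : ℕ} (hk : 1 ≤ k) :
    IsDiagonalUpTo (![zeroId 𝕜 k, idZero 𝕜 k] : Fin 2 → Matrix (Fin k) (Fin (k + 1)) 𝕜) k 1 := by
  obtain ⟨a, ha⟩ : ∃ a : Fin k, (a : ℕ) + 1 = k := ⟨⟨k - 1, by omega⟩, by simp only; omega⟩
  obtain ⟨ρ, d, Y, hY, hd⟩ := (isCyclicVector_nilJordan (𝕜 := 𝕜) ha).exists_diagonalization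
  have hY' := (isUnit_iff_isUnit_det _).1 hY
  have h1 : idZero 𝕜 k * (idZero 𝕜 k)ᵀ = 1 := by
    ext i j
    rw [mul_apply, Finset.sum_eq_single i.castSucc]
    · simp [idZero, one_apply, Fin.ext_iff, eq_comm]
    · intro b _ hb
      have : (i : ℕ) ≠ b := fun e => hb (Fin.ext e.symm)
      simp [idZero, this]
    · simp
  have h2 : zeroId 𝕜 k = nilJordan 𝕜 k * idZero 𝕜 k +
      vecMulVec (Pi.single a 1) (Pi.single (Fin.last k) 1) := by
    ext i j
    induction j using Fin.lastCases with
    | last =>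
      rw [Matrix.add_apply, mul_apply, Finset.sum_eq_zero]
      · by_cases hi : i = a
        · subst hi
          simp [zeroId, vecMulVec_apply, ha]
        · have : (i : ℕ) + 1 ≠ k := fun e => hi (Fin.ext (by omega))
          simp [zeroId, vecMulVec_apply, hi, this]
      · intro b _
        simp [idZero, b.2.ne]
    | cast j =>
      rw [Matrix.add_apply, mul_apply, Finset.sum_eq_single j]
      · simp [zeroId, idZero, nilJordan, vecMulVec_apply]
      · intro b _ hb
        have : (b : ℕ) ≠ j := fun e => hb (Fin.ext e)
        simp [idZero, this]
      · simp
  refine ⟨Y, ![d, 1], Y⁻¹ * idZero 𝕜 k, Y⁻¹, (idZero 𝕜 k)ᵀ * Y, nonsing_inv_mul _ hY', ?_, ?_⟩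
  · rw [Matrix.mul_assoc, ← Matrix.mul_assoc (idZero 𝕜 k), h1, Matrix.one_mul,
      nonsing_inv_mul _ hY']
  · convert isSimpleSum_smul_vecMulVec ![1, 0] (Pi.single a 1)
      (Pi.single (Fin.last k) 1 - ρ ᵥ* idZero 𝕜 k) using 2 with j
    fin_cases j
    · change zeroId 𝕜 k - Y * diagonal d * (Y⁻¹ * idZero 𝕜 k) = (1 : 𝕜) • _
      rw [← Matrix.mul_assoc, ← hd, h2, Matrix.add_mul, vecMulVec_mul, one_smul, vecMulVec_sub]
      abel
    · change idZero 𝕜 k - Y * diagonal 1 * (Y⁻¹ * idZero 𝕜 k) = (0 : 𝕜) • _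
      rw [diagonal_one', Matrix.mul_one, mul_nonsing_inv_cancel_left _ _ hY']
      simp

theorem KroneckerBlock.isDiagonalUpTo {b : KroneckerBlock 𝕜} (hb : b.Admissible)
    (hd : ¬b.IsDefective) : IsDiagonalUpTo b.tensor b.core (b.indE + b.indF) := by
  cases b with
  | typeA k l => exact isDiagonalUpTo_zero
  | typeB x k =>
    obtain rfl : k = 1 := by
      simp only [IsDefective, Admissible] at hd hb
      omega
    exact isDiagonalUpTo_fin_one _
  | typeC c s k => exact absurd trivial hd
  | typeD k =>
    obtain rfl : k = 1 := by
      simp only [IsDefective, Admissible] at hd hb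
      omega
    exact isDiagonalUpTo_fin_one _
  | typeE k => exact isDiagonalUpTo_typeE hb
  | typeF k =>
    have h : IsDiagonalUpTo (![(zeroId 𝕜 k)ᵀ, (idZero 𝕜 k)ᵀ] :
        Fin 2 → Matrix (Fin (k + 1)) (Fin k) 𝕜) k 1 := by
      convert (isDiagonalUpTo_typeE (𝕜 := 𝕜) hb).transpose using 1
      funext j
      fin_cases j <;> rfl
    exact h

end KroneckerUpperBound

/-! ### The upper bound for the rank -/

section Coloring

variable {𝕜 : Type*} [RCLike 𝕜]

/-- The elements of a sigma type, grouped by the values of a map on the index type. -/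
def sigmaSigmaFiberEquiv {I Γ : Type*} (col : I → Γ) (S : I → Type*) :
    ((i : I) × S i) ≃ (c : Γ) × (i : {i // col i = c}) × S i where
  toFun x := ⟨col x.1, ⟨x.1, rfl⟩, x.2⟩
  invFun x := ⟨x.2.1, x.2.2⟩
  left_inv _ := rfl
  right_inv := by
    rintro ⟨_, ⟨i, rfl⟩, a⟩
    rfl

/-- Grouping the blocks of a block diagonal tensor by a map `col`. -/
theorem IsDiagonalUpTo.of_fiberwise {𝕜 : Type*} [Field 𝕜] {I Γ : Type*} [Fintype I] [Fintype Γ]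
    [DecidableEq I] [DecidableEq Γ] {R C : I → Type*} [∀ i, Fintype (R i)] [∀ i, Fintype (C i)]
    {T : ∀ i, Fin 2 → Matrix (R i) (C i) 𝕜} (col : I → Γ) {d p : Γ → ℕ}
    (h : ∀ c, IsDiagonalUpTo (_root_.blockTensor fun i : {i // col i = c} => T i) (d c) (p c)) :
    IsDiagonalUpTo (_root_.blockTensor T) (∑ c, d c) (∑ c, p c) := by
  have key : ∀ k, (_root_.blockTensor T k).submatrix (sigmaSigmaFiberEquiv col R).symm
      (sigmaSigmaFiberEquiv col C).symm =
        _root_.blockTensor (fun c => _root_.blockTensor fun i : {i // col i = c} => T i) k := by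
    intro k
    ext ⟨c, ⟨i, rfl⟩, a⟩ ⟨c', ⟨j, hj⟩, a'⟩
    by_cases hc : col i = c'
    · subst hc
      refine Eq.trans ?_ (blockDiagonal'_apply_eq _ _ _ _).symm
      by_cases hij : i = j
      · subst hij
        exact (blockDiagonal'_apply_eq (fun i => T i k) i a a').trans
          (blockDiagonal'_apply_eq (fun i' : {i' // col i' = col i} => T i' k) ⟨i, rfl⟩ a a').symm
      · exact (blockDiagonal'_apply_ne (fun i => T i k) a a' hij).trans
          (blockDiagonal'_apply_ne (fun i' : {i' // col i' = col i} => T i' k) a a'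
            fun e => hij (congrArg Subtype.val e)).symm
    · have hij : i ≠ j := by
        rintro rfl
        exact hc hj
      exact (blockDiagonal'_apply_ne (fun i => T i k) a a' hij).trans
        (blockDiagonal'_apply_ne _ _ _ hc).symm
  have h2 := (IsDiagonalUpTo.blockTensor h).submatrix (sigmaSigmaFiberEquiv col R)
    (sigmaSigmaFiberEquiv col C)
  simp_rw [← key, submatrix_submatrix, Equiv.symm_comp_self, submatrix_id_id] at h2
  exact h2

/-- The number of defective blocks with a given eigenvalue is one of the numbers whose maximum is
`kroneckerAlpha`. -/
theorem KroneckerBlock.card_sameEigenvalue_le {r : ℕ} {b : Fin r → KroneckerBlock 𝕜}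
    (hb : ∀ i, (b i).Admissible) {i : Fin r} (hi : (b i).IsDefective) :
    {j | (b j).IsDefective ∧ (b j).eigenvalue = (b i).eigenvalue}.ncard ≤ kroneckerAlpha b := by
  have hbdd : ∀ {β : Type _} (S : β → Set (Fin r)), BddAbove (Set.range fun x => (S x).ncard) := by
    rintro β S
    refine ⟨r, ?_⟩
    rintro _ ⟨x, rfl⟩
    simpa using Set.ncard_le_card (S x)
  cases hbi : b i with
  | typeB x k =>
    refine le_trans (Set.ncard_le_ncard (t := {j | ∃ k, 2 ≤ k ∧ b j = .typeB x k}) ?_)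
      (le_trans (le_ciSup (f := fun x => countB b x) (hbdd _) x) (le_max_left _ _))
    rintro j ⟨hj, hj'⟩
    cases hbj : b j <;> simp_all [IsDefective, eigenvalue]
  | typeC c s k =>
    refine le_trans (Set.ncard_le_ncard
      (t := {j | ∃ t k, (t = s ∨ t = -s) ∧ 1 ≤ k ∧ b j = .typeC c t k}) ?_)
      (le_trans (le_ciSup (f := fun p : 𝕜 × 𝕜 => countC b p.1 p.2) (hbdd _) (c, s))
        ((le_max_right _ _).trans (le_max_right _ _)))
    rintro j ⟨hj, hj'⟩
    have := hb j
    cases hbj : b j <;> simp_all [IsDefective, eigenvalue, Admissible, mul_self_eq_mul_self_iff]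
  | typeD k =>
    refine le_trans (Set.ncard_le_ncard (t := {j | ∃ k, 2 ≤ k ∧ b j = .typeD k}) ?_)
      ((le_max_left _ _).trans (le_max_right _ _))
    rintro j ⟨hj, hj'⟩
    cases hbj : b j <;> simp_all [IsDefective, eigenvalue]
  | _ => rw [hbi] at hi; exact hi.elim

/-- The defective blocks can be colored with `kroneckerAlpha b` colors such that blocks of the same
color have different eigenvalues: the color of a block is the number of its predecessors with the
same eigenvalue. -/
theorem KroneckerBlock.exists_coloring {r : ℕ} {b : Fin r → KroneckerBlock 𝕜}
    (hb : ∀ i, (b i).Admissible) :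
    ∃ col : Fin r → Fin (kroneckerAlpha b) ⊕ Fin r,
      (∀ i, ¬(b i).IsDefective → col i = .inr i) ∧
      (∀ i, (b i).IsDefective → ∃ a, col i = .inl a) ∧
      ∀ i j, (b i).IsDefective → (b j).IsDefective → col i = col j →
        (b i).eigenvalue = (b j).eigenvalue → i = j := by
  classical
  let P (i : Fin r) : Set (Fin r) :=
    {j | j < i ∧ (b j).IsDefective ∧ (b j).eigenvalue = (b i).eigenvalue}
  have hlt : ∀ i, (b i).IsDefective → (P i).ncard < kroneckerAlpha b := fun i hi =>
    lt_of_lt_of_le (Set.ncard_lt_ncard ⟨fun j hj => hj.2, fun h => (h ⟨hi, rfl⟩).1.false⟩)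
      (card_sameEigenvalue_le hb hi)
  have hne : ∀ i j, i < j → (b i).IsDefective → (b i).eigenvalue = (b j).eigenvalue →
      (P i).ncard < (P j).ncard := fun i j hij hi he =>
    Set.ncard_lt_ncard ⟨fun l hl => ⟨hl.1.trans hij, hl.2.1, hl.2.2.trans he⟩,
      fun h => (h ⟨hij, hi, he⟩).1.false⟩
  refine ⟨fun i => if hi : (b i).IsDefective then .inl ⟨(P i).ncard, hlt i hi⟩ else .inr i,
    fun i hi => dif_neg hi, fun i hi => ⟨_, dif_pos hi⟩, fun i j hi hj hij he => ?_⟩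
  beta_reduce at hij
  rw [dif_pos hi, dif_pos hj, Sum.inl.injEq, Fin.mk.injEq] at hij
  rcases lt_trichotomy i j with h | h | h
  · exact absurd hij (hne i j h hi he).ne
  · exact h
  · exact absurd hij (hne j i h hj he.symm).ne'

/-- The upper bound for a Kronecker canonical form. The blocks are grouped by a coloring. Each color
in `Fin (kroneckerAlpha b)` needs one simple tensor, and a block that is not defective forms a group
of its own. -/
theorem isDiagonalUpTo_blockTensor {r : ℕ} {b : Fin r → KroneckerBlock 𝕜}
    (hb : ∀ i, (b i).Admissible) :
    IsDiagonalUpTo (blockTensor fun i => (b i).tensor) (∑ i, (b i).core)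
      (kroneckerAlpha b + ∑ i, ((b i).indE + (b i).indF)) := by
  classical
  obtain ⟨col, hcol, hcol', hinj⟩ := KroneckerBlock.exists_coloring hb
  -- a point `t` at which no block of type B is singular
  obtain ⟨t, ht⟩ : ∃ t : 𝕜, ∀ i x k, b i = .typeB x k → x ≠ t := by
    obtain ⟨t, ht⟩ := (Set.finite_range fun i => match b i with
      | .typeB x _ => x
      | _ => (0 : 𝕜)).infinite_compl.nonempty
    refine ⟨t, fun i x k hi e => ht ⟨i, ?_⟩⟩
    simp only [hi, e]
  have h : ∀ c, IsDiagonalUpTo (blockTensor fun i : {i // col i = c} => (b i).tensor)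
      (∑ i : {i // col i = c}, (b i).core)
      (Sum.elim (fun _ => 1) (fun i => (b i).indE + (b i).indF) c) := by
    rintro (a | a)
    · -- a group of defective blocks with different eigenvalues
      have hdef : ∀ i : {i // col i = .inl a}, (b i).IsDefective := fun i => by
        by_contra hi
        have := hcol i hi
        rw [i.2] at this
        cases this
      have h1 := IsCyclicPencil.blockTensor (t := t)
        (fun i : {i // col i = .inl a} => (b i).isCyclicPencil (hb i) (hdef i) (ht i))
        (fun i j hij => KroneckerBlock.isCoprime_annihilator (hb i) (hb j) (hdef i) (hdef j)
          (fun e => hij (Subtype.ext (hinj i j (hdef i) (hdef j) (i.2.trans j.2.symm) e))) t)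
      rw [Sum.elim_inl]
      convert h1.isDiagonalUpTo using 1
      rw [Fintype.card_sigma]
      refine Finset.sum_congr rfl fun i _ => ?_
      have := hdef i
      rw [Fintype.card_fin]
      cases hbi : b i <;> simp_all [KroneckerBlock.core, KroneckerBlock.cols,
        KroneckerBlock.IsDefective]
    · -- at most one block, which is not defective
      have hnot : ∀ i : {i // col i = .inr a}, ¬(b i).IsDefective ∧ i.1 = a := fun i => by
        by_cases hi : (b i).IsDefective
        · obtain ⟨c, hc⟩ := hcol' i hi
          rw [i.2] at hc
          cases hc
        · refine ⟨hi, ?_⟩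
          have := hcol i hi
          rw [i.2] at this
          exact (Sum.inr.inj this).symm
      have : Subsingleton {i // col i = .inr a} :=
        ⟨fun i j => Subtype.ext ((hnot i).2.trans (hnot j).2.symm)⟩
      refine (IsDiagonalUpTo.blockTensor fun i : {i // col i = .inr a} =>
        (b i).isDiagonalUpTo (hb i) (hnot i).1).mono ?_
      rcases isEmpty_or_nonempty {i // col i = .inr a} with h0 | ⟨⟨i, hi⟩⟩
      · simp
      · rw [Fintype.sum_subsingleton _ (⟨i, hi⟩ : {i // col i = .inr a}), Sum.elim_inr,
          (hnot ⟨i, hi⟩).2]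
  convert IsDiagonalUpTo.of_fiberwise (T := fun i => (b i).tensor) col h using 1
  · simp_rw [fun c => sum_subtype_eq_sum_ite (fun i => col i = c) fun i => (b i).core]
    rw [Finset.sum_comm]
    simp
  · simp

end Coloring

/-! ### Diagonalizable tensors and the rank -/

section Rank

variable {𝕜 : Type*} [Field 𝕜] {m n d : ℕ}

/-- Linearly independent columns are mapped to the first standard basis vectors by some nonsingular
matrix. -/
theorem exists_GL_mul_eq {U : Matrix (Fin m) (Fin d) 𝕜} {U' : Matrix (Fin d) (Fin m) 𝕜}
    (h : U' * U = 1) :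
    ∃ P : GL (Fin m) 𝕜, ∀ i s, ((P : Matrix (Fin m) (Fin m) 𝕜) * U) i s =
      if (i : ℕ) = s then 1 else 0 := by
  have hU' : Function.Surjective U'.mulVecLin := fun y => ⟨U *ᵥ y, by simp [h]⟩
  have hfin : Module.finrank 𝕜 U'.mulVecLin.ker = m - d := by
    have := U'.mulVecLin.finrank_range_add_finrank_ker
    rw [LinearMap.range_eq_top.2 hU', finrank_top] at this
    simp only [Module.finrank_fin_fun] at this
    omega
  have hdm : d ≤ m := by
    have := U'.mulVecLin.finrank_range_add_finrank_ker
    rw [LinearMap.range_eq_top.2 hU', finrank_top] at this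
    simp only [Module.finrank_fin_fun] at this
    omega
  -- the columns of `U` and a basis of the kernel of its left inverse make up a nonsingular matrix
  let K := Module.finBasisOfFinrankEq 𝕜 U'.mulVecLin.ker hfin
  let e : Fin d ⊕ Fin (m - d) ≃ Fin m := finSumFinEquiv.trans (finCongr (by omega))
  let N : Matrix (Fin m) (Fin (m - d)) 𝕜 := of fun i s => (K s : Fin m → 𝕜) i
  let M : Matrix (Fin m) (Fin m) 𝕜 := (fromCols U N).submatrix id e.symm
  have hN : U' * N = 0 := by
    ext i s
    exact congrFun (K s).2 i
  have hM : IsUnit M := by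
    rw [← mulVec_injective_iff_isUnit]
    rw [← coe_mulVecLin, injective_iff_map_eq_zero]
    intro x hx
    have h1 : U *ᵥ (x ∘ e ∘ Sum.inl) + N *ᵥ (x ∘ e ∘ Sum.inr) = 0 := by
      rw [← hx]
      ext i
      simp [M, mulVec, dotProduct, ← e.sum_comp]
    have h2 : x ∘ e ∘ Sum.inl = 0 := by
      rw [← one_mulVec (x ∘ e ∘ Sum.inl), ← h, ← mulVec_mulVec, ← mulVec_zero U', ← h1, mulVec_add,
        mulVec_mulVec _ U' N, hN, zero_mulVec, add_zero]
    have h3 : x ∘ e ∘ Sum.inr = 0 := by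
      rw [h2, mulVec_zero, zero_add] at h1
      refine funext (Fintype.linearIndependent_iff.1 K.linearIndependent (x ∘ e ∘ Sum.inr)
        (Subtype.ext ?_))
      refine Eq.trans ?_ h1
      ext i
      simp [N, mulVec, dotProduct, mul_comm]
    refine funext fun i => ?_
    obtain ⟨s | s, rfl⟩ := e.surjective i
    · exact congrFun h2 s
    · exact congrFun h3 s
  obtain ⟨G, hG⟩ := hM
  refine ⟨G⁻¹, fun i s => ?_⟩
  have hU : U = M.submatrix id (e ∘ Sum.inl) := by
    ext i s
    simp [M]
  have h1 : ((G⁻¹ : GL (Fin m) 𝕜) : Matrix (Fin m) (Fin m) 𝕜) * U =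
      (1 : Matrix (Fin m) (Fin m) 𝕜).submatrix id (e ∘ Sum.inl) := by
    rw [hU, ← hG]
    ext i s
    have := congrFun (congrFun (Units.inv_mul G) i) (e (.inl s))
    exact this
  rw [h1]
  simp [one_apply, Fin.ext_iff, e]

theorem IsDiagonalUpTo.exists_isDiagonalizableTensor {T : Fin 2 → Matrix (Fin m) (Fin n) 𝕜}
    {p : ℕ} (h : IsDiagonalUpTo T d p) :
    ∃ E, IsSimpleSum E p ∧ IsSimpleSum (T - E) d ∧ IsDiagonalizableTensor (T - E) := by
  obtain ⟨U, w, V, U', V', hU, hV, h⟩ := h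
  have hE : ∀ k, (T - fun k => T k - U * diagonal (w k) * V) k = U * diagonal (w k) * V :=
    fun k => sub_sub_cancel _ _
  refine ⟨_, h, ⟨U, w, V, hE⟩, ?_⟩
  obtain ⟨P, hP⟩ := exists_GL_mul_eq hU
  obtain ⟨Q, hQ⟩ := exists_GL_mul_eq (U := Vᵀ) (U' := V'ᵀ)
    (by rw [← transpose_mul, hV, transpose_one])
  have hQ' : IsUnit ((Q : Matrix (Fin n) (Fin n) 𝕜)ᵀ) :=
    (isUnit_iff_isUnit_det _).2 (isUnit_det_transpose _ ((isUnit_iff_isUnit_det _).1 Q.isUnit))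
  obtain ⟨R, hR⟩ := hQ'
  refine ⟨P, R, fun k i j hij => ?_⟩
  have h1 : (P : Matrix (Fin m) (Fin m) 𝕜) * (U * diagonal (w k) * V) *
      (R : Matrix (Fin n) (Fin n) 𝕜) =
        ((P : Matrix (Fin m) (Fin m) 𝕜) * U) * diagonal (w k) *
          ((Q : Matrix (Fin n) (Fin n) 𝕜) * Vᵀ)ᵀ := by
    rw [hR, transpose_mul, transpose_transpose]
    simp only [Matrix.mul_assoc]
  rw [hE, h1, mul_apply]
  refine Finset.sum_eq_zero fun s _ => ?_
  rw [mul_diagonal, hP, transpose_apply, hQ]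
  by_cases hi : (i : ℕ) = s
  · rw [if_neg (fun hj : (j : ℕ) = s => hij (hi.trans hj.symm)), mul_zero]
  · rw [if_neg hi, zero_mul, zero_mul]

theorem IsSimpleSum.tensorRank_le {T : Fin 2 → Matrix (Fin m) (Fin n) 𝕜} {p : ℕ}
    (h : IsSimpleSum T p) : tensorRank T ≤ p :=
  Nat.sInf_le ((isSimpleSum_iff_isSumOfSimple T).1 h)

theorem isSimpleSum_tensorRank (T : Fin 2 → Matrix (Fin m) (Fin n) 𝕜) :
    IsSimpleSum T (tensorRank T) :=
  (isSimpleSum_iff_isSumOfSimple T).2 (Nat.sInf_mem (exists_isSumOfSimple T))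

end Rank

/-! ### Counting rows and columns -/

section Counting

variable {𝕜 : Type*} {r : ℕ} (b : Fin r → KroneckerBlock 𝕜)

theorem numTypeE_eq_sum : numTypeE b = ∑ i, (b i).indE := by
  classical
  rw [numTypeE, ← card_subtype_eq_ncard, Fintype.card_subtype, Finset.card_filter]
  refine Finset.sum_congr rfl fun i _ => ?_
  cases b i <;> simp [KroneckerBlock.indE]

theorem numTypeF_eq_sum : numTypeF b = ∑ i, (b i).indF := by
  classical
  rw [numTypeF, ← card_subtype_eq_ncard, Fintype.card_subtype, Finset.card_filter]
  refine Finset.sum_congr rfl fun i _ => ?_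
  cases b i <;> simp [KroneckerBlock.indF]

theorem sum_rows_eq :
    ∑ i, (b i).rows = ∑ i, (b i).core + numZeroRows b + numTypeF b := by
  rw [numTypeF_eq_sum, numZeroRows, ← Finset.sum_add_distrib, ← Finset.sum_add_distrib]
  refine Finset.sum_congr rfl fun i _ => ?_
  cases b i <;> simp [KroneckerBlock.rows, KroneckerBlock.core, KroneckerBlock.zeroRows,
    KroneckerBlock.indF]

theorem sum_cols_eq :
    ∑ i, (b i).cols = ∑ i, (b i).core + numZeroCols b + numTypeE b := by
  rw [numTypeE_eq_sum, numZeroCols, ← Finset.sum_add_distrib, ← Finset.sum_add_distrib]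
  refine Finset.sum_congr rfl fun i _ => ?_
  cases b i <;> simp [KroneckerBlock.cols, KroneckerBlock.core, KroneckerBlock.zeroCols,
    KroneckerBlock.indE]

theorem sum_baseRank_eq :
    ∑ i, (b i).baseRank = ∑ i, (b i).core + numTypeE b + numTypeF b := by
  rw [numTypeE_eq_sum, numTypeF_eq_sum, ← Finset.sum_add_distrib, ← Finset.sum_add_distrib]
  refine Finset.sum_congr rfl fun i _ => ?_
  cases b i <;> simp [KroneckerBlock.baseRank, KroneckerBlock.core, KroneckerBlock.indE,
    KroneckerBlock.indF]

end Counting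

/-! ### The rank and the Kronecker canonical form -/

section Transport

variable {𝕜 : Type*} [RCLike 𝕜] {m n r : ℕ} {T : Fin 2 → Matrix (Fin m) (Fin n) 𝕜}
  {b : Fin r → KroneckerBlock 𝕜}

theorem IsKroneckerCanonicalForm.sum_baseRank_add_kroneckerAlpha_le
    (hb : IsKroneckerCanonicalForm T b) {N : ℕ} (h : IsSimpleSum T N) :
    ∑ i, (b i).baseRank + kroneckerAlpha b ≤ N := by
  obtain ⟨hadm, P, Q, e, f, hT⟩ := hb
  refine _root_.sum_baseRank_add_kroneckerAlpha_le hadm ?_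
  convert (h.mul (P : Matrix (Fin m) (Fin m) 𝕜) (Q : Matrix (Fin n) (Fin n) 𝕜)).submatrix
    e.symm f.symm using 2 with k
  rw [hT, submatrix_submatrix, Equiv.self_comp_symm, Equiv.self_comp_symm, submatrix_id_id]

theorem IsKroneckerCanonicalForm.isDiagonalUpTo (hb : IsKroneckerCanonicalForm T b) :
    IsDiagonalUpTo T (∑ i, (b i).core)
      (kroneckerAlpha b + ∑ i, ((b i).indE + (b i).indF)) := by
  obtain ⟨hadm, P, Q, e, f, hT⟩ := hb
  convert ((isDiagonalUpTo_blockTensor hadm).submatrix e f).mul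
    (P := ((P⁻¹ : GL (Fin m) 𝕜) : Matrix (Fin m) (Fin m) 𝕜)) (P' := P)
    (Q := ((Q⁻¹ : GL (Fin n) 𝕜) : Matrix (Fin n) (Fin n) 𝕜)) (Q' := Q)
    P.mul_inv Q.inv_mul using 2 with k
  rw [← hT, Matrix.mul_assoc (P : Matrix (Fin m) (Fin m) 𝕜), ← Matrix.mul_assoc _
    (P : Matrix (Fin m) (Fin m) 𝕜), Units.inv_mul, Matrix.one_mul, Matrix.mul_assoc, Units.mul_inv,
    Matrix.mul_one]

end Transport

theorem mainTheorem1 {𝕜 : Type*} [RCLike 𝕜] {m n r : ℕ} (A B : Matrix (Fin m) (Fin n) 𝕜)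
    (b : Fin r → KroneckerBlock 𝕜) (hb : IsKroneckerCanonicalForm ![A, B] b) :
    (m : ℤ) - numZeroRows b + numTypeE b = (n : ℤ) - numZeroCols b + numTypeF b ∧
    (tensorRank ![A, B] : ℤ) = kroneckerAlpha b + m - numZeroRows b + numTypeE b ∧
    ∃ T : Fin 2 → Matrix (Fin m) (Fin n) 𝕜,
      tensorRank T = kroneckerAlpha b + numTypeE b + numTypeF b ∧
      IsDiagonalizableTensor (![A, B] + T) := by
  obtain ⟨E, hE, hd, hdiag⟩ := hb.isDiagonalUpTo.exists_isDiagonalizableTensor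
  rw [Finset.sum_add_distrib, ← numTypeE_eq_sum, ← numTypeF_eq_sum] at hE
  have hm : m = ∑ i, (b i).core + numZeroRows b + numTypeF b := by
    obtain ⟨-, -, -, e, -, -⟩ := hb
    rw [← sum_rows_eq]
    simpa using Fintype.card_congr e
  have hn : n = ∑ i, (b i).core + numZeroCols b + numTypeE b := by
    obtain ⟨-, -, -, -, f, -⟩ := hb
    rw [← sum_cols_eq]
    simpa using Fintype.card_congr f
  have hbase := sum_baseRank_eq b
  have hlower {N : ℕ} (h : IsSimpleSum ![A, B] N) := hb.sum_baseRank_add_kroneckerAlpha_le h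
  have h1 := hlower (isSimpleSum_tensorRank _)
  have h2 : IsSimpleSum ![A, B] _ := sub_add_cancel ![A, B] E ▸ hd.add hE
  have h3 := h2.tensorRank_le
  -- the perturbation cannot have a smaller rank, since together with the remaining diagonalizable
  -- tensor it makes up the given one
  have h4 : IsSimpleSum ![A, B] _ :=
    sub_add_cancel ![A, B] E ▸ hd.add (by simpa using (isSimpleSum_tensorRank (-E)).neg)
  have h5 := hlower h4
  have h6 := hE.neg.tensorRank_le
  refine ⟨by omega, by omega, -E, by omega, ?_⟩
  rwa [← sub_eq_add_neg]
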